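/- Let $X,Y$ be real reflexive Banach spaces, let $Z_1,Z_2$ be real Banach spaces, and let $K\subseteq X$ and $\Lambda\subseteq Y$ be nonempty, closed and convex. Let $B:X\times Y\to\mathbb R$, $\phi:X\to(-\infty,\infty]$, $\gamma_1:X\to Z_1$, $\gamma_2:Y\to Z_2$, $J:Z_1\to\mathbb R$, $L:Z_2\to\mathbb R$, $H:Y\to(0,\infty)$, $F:X\to X^*$ and $G:Y\to Y^*$ be given, and let $D(\phi)=\{x\in X:\phi(x)<\infty\}$. For a locally Lipschitz $h:E\to\mathbb R$ on a Banach space $E$ put $h^0(x;y)=\limsup_{z\to x,\,t\downarrow0}\frac{h(z+ty)-h(z)}{t}$ and $\partial_C h(x)=\{\xi\in E^*:\langle\xi,y\rangle\le h^0(x;y)\ \forall y\in E\}$. An operator $A:E\to E^*$ is hemicontinuous if $\lim_{t\to0_+}\langle A(u+t(v-u)),w\rangle=\langle A(u),w\rangle$ for all $u,v,w\in E$. For $\beta:E\to\mathbb R$, a set-valued operator $A:E\to2^{E^*}$ is $\beta$-relaxed dissipative if $\langle\zeta_y-\zeta_x,y-x\rangle\le\beta(y-x)$ for all $x,y\in E$,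 $\zeta_x\in A(x)$, $\zeta_y\in A(y)$; a single-valued operator is identified with the corresponding set-valued one. Assume the following. * $(H_0')$: $\phi$ is convex and lower semicontinuous with $D(\phi)\cap K\ne\emptyset$. The functionals $J$ and $L$ are locally Lipschitz, with Lipschitz constants $c_x$ near $x\in Z_1$ and $c_y$ near $y\in Z_2$, respectively, such that $\sup_{x\in Z_1}c_x\le\alpha_J$ and $\sup_{y\in Z_2}c_y\le\alpha_L$ for some $\alpha_J,\alpha_L>0$. The operators $\gamma_1,\gamma_2$ are linear and compact. There is $m_H>0$ with $0<H(\sigma)<m_H$ for all $\sigma\in Y$, and $H(\sigma_n)\to H(\sigma)$ whenever $\sigma_n\rightharpoonup\sigma$ weakly in $Y$. * $(H_B)$: $B$ is convex and lower semicontinuous on $X\times Y$. * $F$ satisfies at least one of the following: $(H_F^1)$ $\liminf_{n\to\infty}\langle F(u_n),v-u_n\rangle\ge\langle F(u),v-u\rangle$ whenever $v\in X$ and $u_n\rightharpoonup u$ weakly in $X$; $(H_F^2)$ $F$ is hemicontinuous and $\beta_F$-relaxed dissipative for some concave $\beta_F:X\to\mathbb R$ with $\beta_F(0)\le0$; $(H_F^3)$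 $F$ is hemicontinuous and $u\mapsto F(u)-\gamma_1^*\partial_CJ(\gamma_1(u))$ is $\beta_T$-relaxed dissipative for some concave $\beta_T:X\to\mathbb R$ with $\beta_T(0)\le0$. * $G$ satisfies at least one of the following: $(H_G^1)$ $\liminf_{n\to\infty}\langle G(\sigma_n),\mu-\sigma_n\rangle\ge\langle G(\sigma),\mu-\sigma\rangle$ whenever $\mu\in Y$ and $\sigma_n\rightharpoonup\sigma$ weakly in $Y$; $(H_G^2)$ $G$ is hemicontinuous and $\beta_G$-relaxed dissipative for some concave $\beta_G:Y\to\mathbb R$ with $\beta_G(0)\le0$; $(H_G^3)$ $G$ is hemicontinuous and $\sigma\mapsto G(\sigma)-H(\sigma)\gamma_2^*\partial_CL(\gamma_2(\sigma))$ is $\beta_S$-relaxed dissipative for some concave $\beta_S:Y\to\mathbb R$ with $\beta_S(0)\le0$. * Either $K\times\Lambda$ is bounded, or the coercivity condition $(C)$ holds: there exist $\bar w_0\in K\cap D(\phi)$ and $\bar\tau_0\in\Lambda$ such that $$\frac{2B(u,\sigma)-B(\bar w_0,\sigma)-B(u,\bar\tau_0)+\langle F(u),\bar w_0-u\rangle+\langle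 G(\sigma),\bar\tau_0-\sigma\rangle}{\|(u,\sigma)\|}\to\infty$$ as $\|(u,\sigma)\|:=\sqrt{\|u\|_X^2+\|\sigma\|_Y^2}\to\infty$ with $(u,\sigma)\in K\times\Lambda$. Then there exists $(u,\sigma)\in(K\cap D(\phi))\times\Lambda$ such that for all $v\in K$ and all $\mu\in\Lambda$ $$B(v,\sigma)-B(u,\sigma)+\phi(v)-\phi(u)+J^0(\gamma_1(u);\gamma_1(v-u))\ge\langle F(u),v-u\rangle,$$ $$B(u,\mu)-B(u,\sigma)+H(\sigma)L^0(\gamma_2(\sigma);\gamma_2(\mu-\sigma))\ge\langle G(\sigma),\mu-\sigma\rangle.$$ -/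

import Mathlib

open Filter Topology
open scoped NNReal

noncomputable section

namespace CoupledIneq

/-- A real normed space is reflexive when the canonical embedding into its bidual is onto. -/
def Reflexive (E : Type*) [NormedAddCommGroup E] [NormedSpace ℝ E] : Prop :=
  Function.Surjective (NormedSpace.inclusionInDoubleDual ℝ E)

/-- Weak convergence `x n ⇀ a` of a sequence. -/
def WeaklyTendsto {E : Type*} [NormedAddCommGroup E] [NormedSpace ℝ E]
    (x : ℕ → E) (a : E) : Prop :=
  Tendsto (fun n => toWeakSpace ℝ E (x n)) atTop (𝓝 (toWeakSpace ℝ E a))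

/-- Clarke's generalized directional derivative `h⁰(x; y)`, the upper limit of the difference
quotients `(h (z + t y) - h z) / t` as `z → x` and `t ↓ 0`; it is used for locally Lipschitz `h`
only, where these quotients are bounded near the limit. -/
def clarkeDeriv {E : Type*} [NormedAddCommGroup E] [NormedSpace ℝ E]
    (h : E → ℝ) (x y : E) : ℝ :=
  limsup (fun p : E × ℝ => (h (p.1 + p.2 • y) - h p.1) / p.2) (𝓝 x ×ˢ 𝓝[>] (0 : ℝ))

/-- Clarke's subdifferential `∂_C h(x)`. -/
def clarkeSubdiff {E : Type*} [NormedAddCommGroup E] [NormedSpace ℝ E]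
    (h : E → ℝ) (x : E) : Set (StrongDual ℝ E) :=
  {ξ | ∀ y, ξ y ≤ clarkeDeriv h x y}

/-- `h` has local Lipschitz constants `c x` (near each point `x`) bounded by one `α > 0`. -/
def BoundedLocalLipschitz {E : Type*} [NormedAddCommGroup E] (h : E → ℝ) : Prop :=
  ∃ (c : E → ℝ≥0) (α : ℝ≥0), 0 < α ∧
    (∀ x, ∃ U ∈ 𝓝 x, LipschitzOnWith (c x) h U) ∧ ∀ x, c x ≤ α

/-- Effective domain of an extended real functional. -/
def effDomain {E : Type*} (φ : E → EReal) : Set E := {x | φ x < ⊤}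

/-- Convexity of a functional with values in `(-∞, ∞]`. -/
def ERealConvex {E : Type*} [NormedAddCommGroup E] [NormedSpace ℝ E] (φ : E → EReal) : Prop :=
  ∀ x y : E, ∀ t : ℝ, 0 ≤ t → t ≤ 1 →
    φ (t • x + (1 - t) • y) ≤ (t : EReal) * φ x + ((1 - t : ℝ) : EReal) * φ y

/-- The set-valued operator `A` is `β`-relaxed dissipative. -/
def RelaxedDissipative {E : Type*} [NormedAddCommGroup E] [NormedSpace ℝ E]
    (A : E → Set (StrongDual ℝ E)) (β : E → ℝ) : Prop :=
  ∀ x y : E, ∀ ζx ∈ A x, ∀ ζy ∈ A y, (ζy - ζx) (y - x) ≤ β (y - x)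

/-- There is a concave `β` with `β 0 ≤ 0` for which `A` is `β`-relaxed dissipative. -/
def ConcaveRelaxedDissipative {E : Type*} [NormedAddCommGroup E] [NormedSpace ℝ E]
    (A : E → Set (StrongDual ℝ E)) : Prop :=
  ∃ β : E → ℝ, ConcaveOn ℝ Set.univ β ∧ β 0 ≤ 0 ∧ RelaxedDissipative A β

/-- Hemicontinuity of a single-valued operator into the dual. -/
def Hemicontinuous {E : Type*} [NormedAddCommGroup E] [NormedSpace ℝ E]
    (A : E → StrongDual ℝ E) : Prop :=
  ∀ u v w : E, Tendsto (fun t : ℝ => A (u + t • (v - u)) w) (𝓝[>] 0) (𝓝 (A u w))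

/-- First condition on an operator `A`: for each `v`, the map `u ↦ ⟨A u, v - u⟩` is weakly
(sequentially) lower semicontinuous. The lower limit is taken in the extended reals. -/
def OpCond1 {E : Type*} [NormedAddCommGroup E] [NormedSpace ℝ E]
    (A : E → StrongDual ℝ E) : Prop :=
  ∀ (v u : E) (x : ℕ → E), WeaklyTendsto x u →
    ((A u (v - u) : ℝ) : EReal) ≤ liminf (fun n => ((A (x n) (v - x n) : ℝ) : EReal)) atTop

/-- Second condition: `A` is hemicontinuous and relaxed dissipative. -/
def OpCond2 {E : Type*} [NormedAddCommGroup E] [NormedSpace ℝ E]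
    (A : E → StrongDual ℝ E) : Prop :=
  Hemicontinuous A ∧ ConcaveRelaxedDissipative (fun u => {A u})

/-- Third condition: `A` is hemicontinuous and the set-valued operator
`u ↦ A u - c u • γ* ∂_C h (γ u)` is relaxed dissipative, where `γ* ξ = ξ ∘ γ`. -/
def OpCond3 {E Z : Type*} [NormedAddCommGroup E] [NormedSpace ℝ E]
    [NormedAddCommGroup Z] [NormedSpace ℝ Z]
    (A : E → StrongDual ℝ E) (c : E → ℝ) (γ : E →L[ℝ] Z) (h : Z → ℝ) : Prop :=
  Hemicontinuous A ∧
    ConcaveRelaxedDissipative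
      (fun u => (fun ξ : StrongDual ℝ Z => A u - c u • ξ.comp γ) '' clarkeSubdiff h (γ u))

/-- The Euclidean product norm on `X × Y`. -/
def pairNorm {X Y : Type*} [NormedAddCommGroup X] [NormedAddCommGroup Y] (p : X × Y) : ℝ :=
  Real.sqrt (‖p.1‖ ^ 2 + ‖p.2‖ ^ 2)

/-- The coercivity condition: for some `w₀ ∈ K ∩ D(φ)` and `τ₀ ∈ Λ` the quotient below tends to
`∞` as `‖(u, σ)‖ → ∞` with `(u, σ) ∈ K × Λ`. -/
def Coercive {X Y : Type*} [NormedAddCommGroup X] [NormedSpace ℝ X]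
    [NormedAddCommGroup Y] [NormedSpace ℝ Y] (K : Set X) (Λ : Set Y) (φ : X → EReal)
    (B : X × Y → ℝ) (F : X → StrongDual ℝ X) (G : Y → StrongDual ℝ Y) : Prop :=
  ∃ w₀ ∈ K ∩ effDomain φ, ∃ τ₀ ∈ Λ,
    Tendsto
      (fun p : X × Y =>
        (2 * B (p.1, p.2) - B (w₀, p.2) - B (p.1, τ₀)
          + F p.1 (w₀ - p.1) + G p.2 (τ₀ - p.2)) / pairNorm p)
      (comap pairNorm atTop ⊓ 𝓟 (K ×ˢ Λ)) atTop

/-- `(u, σ)` solves the coupled system of inequalities on `K × Λ`. In the first inequality `φ u` is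
finite (for `φ` with values in `(-∞, ∞]`), while `φ v` may be `∞`. -/
def IsSolution {X Y Z₁ Z₂ : Type*}
    [NormedAddCommGroup X] [NormedSpace ℝ X] [NormedAddCommGroup Y] [NormedSpace ℝ Y]
    [NormedAddCommGroup Z₁] [NormedSpace ℝ Z₁] [NormedAddCommGroup Z₂] [NormedSpace ℝ Z₂]
    (K : Set X) (Λ : Set Y) (B : X × Y → ℝ) (φ : X → EReal)
    (γ₁ : X →L[ℝ] Z₁) (γ₂ : Y →L[ℝ] Z₂) (J : Z₁ → ℝ) (L : Z₂ → ℝ) (H : Y → ℝ)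
    (F : X → StrongDual ℝ X) (G : Y → StrongDual ℝ Y) (u : X) (σ : Y) : Prop :=
  u ∈ K ∩ effDomain φ ∧ σ ∈ Λ ∧
    (∀ v ∈ K,
      ((F u (v - u) : ℝ) : EReal) ≤
        ((B (v, σ) - B (u, σ) : ℝ) : EReal) + (φ v - φ u)
          + (clarkeDeriv J (γ₁ u) (γ₁ (v - u)) : EReal)) ∧
    (∀ μ ∈ Λ,
      G σ (μ - σ) ≤
        B (u, μ) - B (u, σ) + H σ * clarkeDeriv L (γ₂ σ) (γ₂ (μ - σ)))

end CoupledIneq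

end

/-!
Adding the two inequalities gives an equilibrium problem on `K × Λ`: find `p` with
`ψ p ≤ f p (q - p) + ψ q` for all `q`, where the energy `ψ (u, σ) = B (u, σ) + φ u` is convex and
the bifunction `f` is sublinear in the direction. Conversely, the test points `q = (v, σ)` and
`q = (u, μ)` recover the two inequalities.

Each alternative for `F` and `G` provides a Minty companion of `f`: a bifunction `f' ≥ f` that is
weakly upper semicontinuous and has no larger slope at `0`. By convexity of `ψ` an equilibrium for
`f'` is one for `f`. The sets of all `p` with `ψ p ≤ f' p (q - p) + ψ q` satisfy the covering
condition of the Knaster–Kuratowski–Mazurkiewicz theorem because `ψ p ≤ f p (q - p) + ψ q` holds at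
`q = p` and the right-hand side is convex in `q`; hence finitely many of them meet. On a bounded set
all of them meet, since bounded, weakly sequentially closed subsets of a reflexive space are weakly
compact.

In the unbounded case one solves on a large ball. Coercivity makes the left-hand sides, tested
against the fixed pair, grow faster than linearly, whereas `φ` and the Clarke derivatives contribute
at most linear terms; so the solution lies in the open ball, and is then global by convexity.
-/

namespace CoupledIneq

section NoRetraction

open MeasureTheory Metric Module Polynomial

theorem exists_polynomial_eval_eq_det_one_add_smul {R M : Type*} [CommRing R] [AddCommGroup M]
    [Module R M] [Module.Free R M] [Module.Finite R M] (A : M →ₗ[R] M) :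
    ∃ p : R[X], p.natDegree ≤ finrank R M ∧ ∀ t, p.eval t = LinearMap.det (1 + t • A) := by
  classical
  let b := Free.chooseBasis R M
  refine ⟨((X : R[X]) • (LinearMap.toMatrix b b A).map C +
    (1 : Matrix (Free.ChooseBasisIndex R M) (Free.ChooseBasisIndex R M) R).map C).det, ?_, ?_⟩
  · nontriviality R
    rw [finrank_eq_card_chooseBasisIndex]
    exact natDegree_det_X_add_C_le _ _
  · intro t
    rw [← LinearMap.det_toMatrix b, ← coe_evalRingHom, RingHom.map_det]
    congr 1
    ext i j
    by_cases hij : i = j <;> simp [hij, add_comm, mul_comm t, LinearMap.toMatrix_one]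

theorem exists_det_one_add_eq_sum {K V : Type*} [Field K] [AddCommGroup V] [Module K V]
    [FiniteDimensional K V] {v : Fin (finrank K V + 1) → K} (hv : Function.Injective v) :
    ∃ c : Fin (finrank K V + 1) → K, ∑ i, c i = 1 ∧
      ∀ A : V →ₗ[K] V, LinearMap.det (1 + A) = ∑ i, c i * LinearMap.det (1 + v i • A) := by
  refine ⟨fun i => (Lagrange.basis Finset.univ v i).eval 1, ?_, fun A => ?_⟩
  · rw [← eval_finsetSum, Lagrange.sum_basis hv.injOn Finset.univ_nonempty, eval_one]
  · obtain ⟨p, hp, heval⟩ := exists_polynomial_eval_eq_det_one_add_smul A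
    have hdeg : p.degree < (Finset.univ : Finset (Fin (finrank K V + 1))).card := by
      rw [Finset.card_fin]
      exact (degree_lt_iff_coeff_zero _ _).2 fun m hm => coeff_eq_zero_of_natDegree_lt (by omega)
    have h := congrArg (eval 1) (Lagrange.eq_interpolate hv.injOn hdeg)
    simpa only [Lagrange.interpolate_apply, eval_finsetSum, eval_mul, eval_C, heval, one_smul,
      mul_comm] using h

variable {E : Type*} [NormedAddCommGroup E]

theorem image_ball_eq_of_approximatesLinearOn_id [NormedSpace ℝ E] [FiniteDimensional ℝ E]
    {f : E → E} {c : ℝ≥0} {R : ℝ} (hR : 0 < R)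
    (hf : ApproximatesLinearOn f (ContinuousLinearMap.id ℝ E) (closedBall 0 R) c) (hc : c < 1)
    (hball : Set.MapsTo f (ball 0 R) (ball 0 R)) (hsphere : Set.EqOn f id (sphere 0 R)) :
    f '' ball 0 R = ball 0 R := by
  refine hball.image_subset.antisymm ?_
  refine (convex_ball (0 : E) R).isPreconnected.subset_of_closure_inter_subset ?_ ?_ ?_
  · refine (hf.mono_set ball_subset_closedBall).open_image
      { toFun := id, nnnorm := 1, bound' := by simp, right_inv' := fun _ => rfl } isOpen_ball
      (Or.inr (by simpa using hc))
  · exact ⟨f 0, hball (mem_ball_self hR), Set.mem_image_of_mem f (mem_ball_self hR)⟩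
  · rintro y ⟨hy, hyR⟩
    have hclosed : IsClosed (f '' closedBall 0 R) :=
      ((isCompact_closedBall 0 R).image_of_continuousOn hf.continuousOn).isClosed
    obtain ⟨x, hx, rfl⟩ := closure_minimal (Set.image_mono ball_subset_closedBall) hclosed hy
    refine Set.mem_image_of_mem f (mem_ball.2 ((mem_closedBall.1 hx).lt_of_ne fun hxR => ?_))
    rw [hsphere hxR] at hyR
    exact hyR.ne hxR

theorem integral_det_ball_eq_of_approximatesLinearOn_id [NormedSpace ℝ E] [FiniteDimensional ℝ E]
    [MeasurableSpace E] [BorelSpace E] (μ : Measure E) [μ.IsAddHaarMeasure] {f : E → E}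
    {f' : E → E →L[ℝ] E} {c : ℝ≥0} {R : ℝ} (hR : 0 < R)
    (hf : ApproximatesLinearOn f (ContinuousLinearMap.id ℝ E) (closedBall 0 R) c) (hc : c < 1)
    (hball : Set.MapsTo f (ball 0 R) (ball 0 R)) (hsphere : Set.EqOn f id (sphere 0 R))
    (hf' : ∀ x ∈ ball 0 R, HasFDerivAt f (f' x) x) (hdet : ∀ x ∈ ball 0 R, 0 ≤ (f' x).det) :
    ∫ x in ball 0 R, (f' x).det ∂μ = μ.real (ball 0 R) := by
  have hinj : Set.InjOn f (ball 0 R) := fun x hx y hy hxy => by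
    have h := hf x (ball_subset_closedBall hx) y (ball_subset_closedBall hy)
    rw [hxy, sub_self, zero_sub, norm_neg, ContinuousLinearMap.id_apply] at h
    exact sub_eq_zero.1 <| norm_eq_zero.1 <| by
      nlinarith [norm_nonneg (x - y), NNReal.coe_lt_one.2 hc]
  have hvol := integral_image_eq_integral_abs_det_fderiv_smul μ measurableSet_ball
    (fun x hx => (hf' x hx).hasFDerivWithinAt) hinj fun _ => (1 : ℝ)
  rw [image_ball_eq_of_approximatesLinearOn_id hR hf hc hball hsphere] at hvol
  simp only [smul_eq_mul, mul_one, setIntegral_const] at hvol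
  rw [hvol]
  exact setIntegral_congr_fun measurableSet_ball fun x hx => (abs_of_nonneg (hdet x hx)).symm

theorem mapsTo_ball_add_smul [NormedSpace ℝ E] {g : E → E} {R t : ℝ}
    (hg : Set.MapsTo (fun x => x + g x) (ball 0 R) (closedBall 0 R)) (ht0 : 0 ≤ t) (ht1 : t < 1) :
    Set.MapsTo (fun x => x + t • g x) (ball 0 R) (ball 0 R) := by
  intro x hx
  have hxg := mem_closedBall_zero_iff.1 (hg hx)
  rw [mem_ball_zero_iff] at hx ⊢
  calc ‖x + t • g x‖ = ‖(1 - t) • x + t • (x + g x)‖ := by congr 1; module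
    _ ≤ (1 - t) * ‖x‖ + t * ‖x + g x‖ := by
      refine (norm_add_le _ _).trans_eq ?_
      rw [norm_smul_of_nonneg (sub_nonneg.2 ht1.le), norm_smul_of_nonneg ht0]
    _ < R := by nlinarith

theorem eventually_integral_det_one_add_smul_fderiv [NormedSpace ℝ E] [FiniteDimensional ℝ E]
    [MeasurableSpace E] [BorelSpace E] (μ : Measure E) [μ.IsAddHaarMeasure] {g : E → E} {R : ℝ}
    (hR : 0 < R) (hg : ContDiff ℝ 1 g)
    (hball : Set.MapsTo (fun x => x + g x) (closedBall 0 R) (closedBall 0 R))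
    (hsphere : ∀ x ∈ sphere (0 : E) R, g x = 0) :
    ∀ᶠ t in 𝓝[>] (0 : ℝ), ∫ x in ball 0 R, (1 + t • fderiv ℝ g x).det ∂μ = μ.real (ball 0 R) := by
  obtain ⟨M, hM⟩ : ∃ M, ∀ x ∈ closedBall (0 : E) R, ‖fderiv ℝ g x‖ ≤ M :=
    (isCompact_closedBall 0 R).exists_bound_of_continuousOn
      (hg.continuous_fderiv one_ne_zero).continuousOn
  obtain ⟨ε, hε, hεdet⟩ : ∃ ε > 0, ∀ A : E →L[ℝ] E, dist A 1 < ε → 0 < A.det :=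
    Metric.eventually_nhds_iff.1 <| ContinuousLinearMap.continuous_det.continuousAt
      |>.eventually_const_lt (by simp [ContinuousLinearMap.det])
  have hsmall : ∀ᶠ t in 𝓝[>] (0 : ℝ), t * M < min 1 ε :=
    ((continuous_mul_const M).tendsto' 0 0 (zero_mul M)).mono_left nhdsWithin_le_nhds
      |>.eventually_lt_const (lt_min one_pos hε)
  filter_upwards [hsmall, Ioo_mem_nhdsGT one_pos] with t htM ⟨ht0, ht1⟩
  obtain ⟨htM1, htMε⟩ := lt_min_iff.1 htM
  have hM0 : 0 ≤ M := (norm_nonneg _).trans (hM 0 (mem_closedBall_self hR.le))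
  have hderiv (x : E) : HasFDerivAt (fun x => t • g x) (t • fderiv ℝ g x) x :=
    (hg.differentiable one_ne_zero x).hasFDerivAt.const_smul t
  have hnorm (x : E) (hx : x ∈ closedBall 0 R) : ‖t • fderiv ℝ g x‖ ≤ t * M := by
    rw [norm_smul, Real.norm_of_nonneg ht0.le]
    exact mul_le_mul_of_nonneg_left (hM x hx) ht0.le
  have happrox : ApproximatesLinearOn (fun x => x + t • g x) (ContinuousLinearMap.id ℝ E)
      (closedBall 0 R) ⟨t * M, by positivity⟩ := by
    refine LipschitzOnWith.approximatesLinearOn ?_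
    have heq : (fun x => x + t • g x) - ContinuousLinearMap.id ℝ E = fun x => t • g x := by
      ext x; simp
    rw [heq]
    exact (convex_closedBall 0 R).lipschitzOnWith_of_nnnorm_hasFDerivWithin_le
      (fun x _ => (hderiv x).hasFDerivWithinAt) hnorm
  refine integral_det_ball_eq_of_approximatesLinearOn_id μ hR happrox htM1
    (mapsTo_ball_add_smul (hball.mono_left ball_subset_closedBall) ht0.le ht1)
    (fun x hx => by simp [hsphere x hx]) (fun x _ => (hasFDerivAt_id x).add (hderiv x))
    fun x hx => (hεdet _ ?_).le
  rw [dist_eq_norm, add_sub_cancel_left]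
  exact (hnorm x (ball_subset_closedBall hx)).trans_lt htMε

theorem integral_det_one_add_fderiv_eq [NormedSpace ℝ E] [FiniteDimensional ℝ E]
    [MeasurableSpace E] [BorelSpace E] (μ : Measure E) [μ.IsAddHaarMeasure] {g : E → E} {R : ℝ}
    (hR : 0 < R) (hg : ContDiff ℝ 1 g)
    (hball : Set.MapsTo (fun x => x + g x) (closedBall 0 R) (closedBall 0 R))
    (hsphere : ∀ x ∈ sphere (0 : E) R, g x = 0) :
    ∫ x in ball 0 R, (1 + fderiv ℝ g x).det ∂μ = μ.real (ball 0 R) := by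
  -- The integral of `det (1 + t g')` is polynomial in `t` and constant for small `t > 0`.
  obtain ⟨δ, hδ, hvol⟩ := mem_nhdsGT_iff_exists_Ioo_subset.1 <|
    eventually_integral_det_one_add_smul_fderiv μ hR hg hball hsphere
  let nodes : ℕ ↪ Set.Ioo 0 δ := (Set.Ioo_infinite hδ).natEmbedding
  obtain ⟨c, hc1, hc⟩ := exists_det_one_add_eq_sum (K := ℝ) (V := E) (v := fun i => (nodes i : ℝ))
    (Subtype.val_injective.comp (nodes.injective.comp Fin.val_injective))
  have hint (t : ℝ) : IntegrableOn (fun x => (1 + t • fderiv ℝ g x).det) (ball 0 R) μ := by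
    have hcont : Continuous fun x => (1 + t • fderiv ℝ g x).det :=
      ContinuousLinearMap.continuous_det.comp
        (continuous_const.add ((hg.continuous_fderiv one_ne_zero).const_smul t))
    exact (hcont.continuousOn.integrableOn_compact (isCompact_closedBall 0 R)).mono_set
      ball_subset_closedBall
  have hdet (x : E) : (1 + fderiv ℝ g x).det =
      ∑ i, c i * (1 + (nodes i : ℝ) • fderiv ℝ g x).det := hc (fderiv ℝ g x)
  simp_rw [hdet]
  rw [integral_finsetSum _ fun i _ => (hint _).const_mul _]
  simp_rw [integral_const_mul]
  rw [Finset.sum_congr rfl fun i _ => congrArg (c i * ·) (hvol (nodes i).2), ← Finset.sum_mul,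
    hc1, one_mul]

theorem det_fderiv_eq_zero_of_norm_eventuallyEq [InnerProductSpace ℝ E] [FiniteDimensional ℝ E]
    {r : E → E} {R : ℝ} (hR : R ≠ 0) {x : E} (hr : DifferentiableAt ℝ r x)
    (hnorm : ∀ᶠ y in 𝓝 x, ‖r y‖ = R) : (fderiv ℝ r x).det = 0 := by
  have horth (v : E) : inner ℝ (r x) (fderiv ℝ r x v) = 0 := by
    have hconst : (fun y => ‖r y‖ ^ 2) =ᶠ[𝓝 x] fun _ => R ^ 2 :=
      hnorm.mono fun y hy => congrArg (· ^ 2) hy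
    have hderiv := hr.hasFDerivAt.norm_sq.unique
      ((hasFDerivAt_const _ x).congr_of_eventuallyEq hconst)
    simpa using DFunLike.congr_fun hderiv v
  by_contra hdet
  obtain ⟨v, hv⟩ : ∃ v, fderiv ℝ r x v = r x :=
    LinearMap.range_eq_top.1 ((LinearMap.isUnit_iff_range_eq_top _).1
      ((LinearMap.isUnit_iff_isUnit_det _).2 (isUnit_iff_ne_zero.2 hdet))) (r x)
  have hself := horth v
  rw [hv, real_inner_self_eq_norm_sq, hnorm.self_of_nhds] at hself
  exact hR (pow_eq_zero_iff two_ne_zero |>.1 hself)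

theorem not_contDiff_retraction_sphere [InnerProductSpace ℝ E] [FiniteDimensional ℝ E]
    {R : ℝ} (hR : 0 < R) {r : E → E} (hnorm : ∀ x ∈ closedBall 0 R, ‖r x‖ = R)
    (hsphere : ∀ x ∈ sphere 0 R, r x = x) : ¬ ContDiff ℝ 1 r := by
  intro hr
  borelize E
  let μ : Measure E := Measure.addHaar
  let g : E → E := fun x => r x - x
  have hvol : ∫ x in ball 0 R, (1 + fderiv ℝ g x).det ∂μ = μ.real (ball 0 R) :=
    integral_det_one_add_fderiv_eq μ hR (hr.sub contDiff_id)
      (fun x hx => by simp [g, hnorm x hx]) fun x hx => by simp [g, hsphere x hx]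
  have hzero : ∀ x ∈ ball 0 R, (1 + fderiv ℝ g x).det = 0 := fun x hx => by
    have hrx : DifferentiableAt ℝ r x := hr.differentiable one_ne_zero x
    rw [show fderiv ℝ g x = fderiv ℝ r x - 1 from (hrx.hasFDerivAt.sub (hasFDerivAt_id x)).fderiv,
      add_sub_cancel]
    exact det_fderiv_eq_zero_of_norm_eventuallyEq hR.ne' hrx <|
      (isOpen_ball.eventually_mem hx).mono fun y hy => hnorm y (ball_subset_closedBall hy)
  rw [setIntegral_congr_fun measurableSet_ball hzero, integral_zero] at hvol
  exact (ENNReal.toReal_pos (measure_ball_pos μ 0 hR).ne' measure_ball_lt_top.ne).ne hvol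

theorem exists_eq_neg_of_hasCompactSupport [InnerProductSpace ℝ E] [FiniteDimensional ℝ E]
    {g : E → E} (hg : Continuous g) (hsupp : HasCompactSupport g) : ∃ x, g x = -x := by
  by_contra! hne
  obtain ⟨R, hR, hRsupp⟩ := hsupp.isCompact.isBounded.subset_ball_lt 0 0
  have hpos (x : E) : 0 < ‖x + g x‖ :=
    norm_pos_iff.2 fun h => hne x (eq_neg_of_add_eq_zero_right h)
  obtain ⟨g', hg', hclose, hsupp'⟩ :=
    hg.exists_contDiff_approx 1 (continuous_id'.add hg).norm hpos
  let w : E → E := fun x => x + g' x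
  have hw : ContDiff ℝ 1 w := contDiff_id.add hg'
  have hw0 (x : E) : w x ≠ 0 := fun h => by
    have hx := hclose x
    rw [eq_neg_of_add_eq_zero_right h, dist_comm, dist_eq_norm, sub_neg_eq_add, add_comm] at hx
    exact hx.false
  refine not_contDiff_retraction_sphere hR (r := fun x => (R / ‖w x‖) • w x) (fun x _ => ?_)
    (fun x hx => ?_)
    ((contDiff_const.div (hw.norm ℝ hw0) fun x => norm_ne_zero_iff.2 (hw0 x)).smul hw)
  · rw [norm_smul_of_nonneg (by positivity), div_mul_cancel₀ _ (norm_ne_zero_iff.2 (hw0 x))]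
  · have hxg : g' x = 0 := by
      by_contra h
      exact (mem_ball.1 (hRsupp (subset_tsupport g (hsupp' h)))).ne hx
    have hwx : w x = x := by simp [w, hxg]
    rw [hwx, mem_sphere_zero_iff_norm.1 hx, div_self hR.ne', one_smul]

variable [NormedSpace ℝ E] [FiniteDimensional ℝ E]

theorem exists_isFixedPt_of_hasCompactSupport {f : E → E} (hf : Continuous f)
    (hsupp : HasCompactSupport f) : ∃ x, Function.IsFixedPt f x := by
  let e : E ≃L[ℝ] EuclideanSpace ℝ (Fin (finrank ℝ E)) := toEuclidean
  obtain ⟨y, hy⟩ := exists_eq_neg_of_hasCompactSupport (g := fun y => -e (f (e.symm y)))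
    (by fun_prop) ((hsupp.comp_homeomorph e.symm.toHomeomorph).comp_left (map_zero e)).neg
  exact ⟨e.symm y, e.injective ((neg_injective hy).trans (e.apply_symm_apply y).symm)⟩

theorem exists_isFixedPt_of_isBounded_range {f : E → E} (hf : Continuous f)
    (hbdd : Bornology.IsBounded (Set.range f)) : ∃ x, Function.IsFixedPt f x := by
  obtain ⟨M, hM⟩ := hbdd.exists_norm_le
  obtain ⟨χ, hχone, -, hχsupp, hχ⟩ := exists_continuous_one_zero_of_isCompact
    (isCompact_closedBall (0 : E) M) isClosed_empty (Set.disjoint_empty _)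
  obtain ⟨x, hx⟩ := exists_isFixedPt_of_hasCompactSupport (f := fun x => χ x • f x)
    (χ.continuous.smul hf) hχsupp.smul_right
  have hxM : x ∈ closedBall 0 M := by
    rw [mem_closedBall_zero_iff, ← hx, norm_smul_of_nonneg (hχ x).1]
    exact (mul_le_of_le_one_left (norm_nonneg _) (hχ x).2).trans (hM _ (Set.mem_range_self x))
  have hfix : χ x • f x = x := hx
  rw [hχone hxM, Pi.one_apply, one_smul] at hfix
  exact ⟨x, hfix⟩

end NoRetraction

section KKM

open Metric

variable {ι : Type*} [Fintype ι]

theorem exists_mem_stdSimplex_forall_eq_zero [Nonempty ι] {d : (ι → ℝ) → ι → ℝ}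
    (hd : Continuous d) (hd0 : ∀ x i, 0 ≤ d x i)
    (hcover : ∀ x ∈ stdSimplex ℝ ι, ∃ i, 0 < x i ∧ d x i = 0) :
    ∃ x ∈ stdSimplex ℝ ι, d x = 0 := by
  let s : (ι → ℝ) → ℝ := fun x => ∑ i, (x i)⁺
  let N : (ι → ℝ) → ι → ℝ := fun x i => (x i)⁺ + (1 - s x)⁺ + d x i
  have hN0 (x : ι → ℝ) (i : ι) : 0 ≤ N x i :=
    add_nonneg (add_nonneg (posPart_nonneg _) (posPart_nonneg _)) (hd0 x i)
  have hpos (x : ι → ℝ) : 0 < ∑ i, N x i := by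
    have hsum : ∑ i, N x i = s x + Fintype.card ι * (1 - s x)⁺ + ∑ i, d x i := by
      simp [N, s, Finset.sum_add_distrib]
    have hcard : (1 : ℝ) ≤ Fintype.card ι := mod_cast Fintype.card_pos
    have hd0' : 0 ≤ ∑ i, d x i := Finset.sum_nonneg fun i _ => hd0 x i
    nlinarith [le_posPart (1 - s x), posPart_nonneg (1 - s x)]
  have hN (i : ι) : Continuous fun x => N x i := by
    simp only [N, s, posPart_def]
    fun_prop
  have hmem (x : ι → ℝ) : (fun i => N x i / ∑ j, N x j) ∈ stdSimplex ℝ ι :=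
    ⟨fun i => div_nonneg (hN0 x i) (hpos x).le, by rw [← Finset.sum_div, div_self (hpos x).ne']⟩
  obtain ⟨x, hx⟩ := exists_isFixedPt_of_isBounded_range (f := fun x i => N x i / ∑ j, N x j)
    (continuous_pi fun i => (hN i).div (continuous_finsetSum _ fun j _ => hN j) fun x =>
      (hpos x).ne') ((isCompact_stdSimplex ℝ ι).isBounded.subset (Set.range_subset_iff.2 hmem))
  have hxmem : x ∈ stdSimplex ℝ ι := hx ▸ hmem x
  have hpart (i : ι) : (x i)⁺ = x i := posPart_of_nonneg (hxmem.1 i)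
  have hs : s x = 1 := by simpa only [s, hpart] using hxmem.2
  have hNx (i : ι) : N x i = x i + d x i := by simp [N, hpart, hs]
  have hfix (i : ι) : d x i = x i * ∑ j, d x j := by
    have h : N x i / ∑ j, N x j = x i := congrFun hx i
    rw [div_eq_iff (hpos x).ne'] at h
    simp only [hNx, Finset.sum_add_distrib, hxmem.2] at h
    linarith
  obtain ⟨i, hi, hdi⟩ := hcover x hxmem
  have hsum : ∑ j, d x j = 0 := by
    simpa [hdi, hi.ne'] using hfix i
  exact ⟨x, hxmem, funext fun i => by rw [hfix i, hsum, mul_zero, Pi.zero_apply]⟩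

theorem exists_mem_stdSimplex_forall_mem [Nonempty ι] {A : ι → Set (ι → ℝ)}
    (hA : ∀ i, IsClosed (A i)) (hcover : ∀ x ∈ stdSimplex ℝ ι, ∃ i, 0 < x i ∧ x ∈ A i) :
    ∃ x ∈ stdSimplex ℝ ι, ∀ i, x ∈ A i := by
  classical
  have hne (i : ι) : (A i).Nonempty := by
    obtain ⟨j, hj, hmem⟩ := hcover _ (single_mem_stdSimplex ℝ i)
    obtain rfl : j = i := by
      by_contra hji
      simp [hji] at hj
    exact ⟨_, hmem⟩
  obtain ⟨x, hx, hzero⟩ := exists_mem_stdSimplex_forall_eq_zero (d := fun x i => infDist x (A i))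
    (continuous_pi fun i => continuous_infDist_pt _) (fun _ _ => infDist_nonneg)
    fun x hx => (hcover x hx).imp fun i hi => ⟨hi.1, infDist_zero_of_mem hi.2⟩
  exact ⟨x, hx, fun i => ((hA i).mem_iff_infDist_zero (hne i)).2 (congrFun hzero i)⟩

end KKM

section Weak

variable {E F : Type*} [NormedAddCommGroup E] [NormedSpace ℝ E]
  [NormedAddCommGroup F] [NormedSpace ℝ F]

theorem continuous_weakSpace_eval (f : StrongDual ℝ E) :
    Continuous fun y : WeakSpace ℝ E => f ((toWeakSpace ℝ E).symm y) :=
  WeakBilin.eval_continuous (topDualPairing ℝ E).flip f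

theorem weaklyTendsto_iff {x : ℕ → E} {a : E} :
    WeaklyTendsto x a ↔ ∀ f : StrongDual ℝ E, Tendsto (fun n => f (x n)) atTop (𝓝 (f a)) := by
  refine WeakBilin.tendsto_iff_forall_eval_tendsto (topDualPairing ℝ E).flip fun x y h => ?_
  exact (NormedSpace.inclusionInDoubleDualLi (𝕜 := ℝ) (E := E)).injective
    (ContinuousLinearMap.ext fun f => LinearMap.congr_fun h f)

theorem weaklyTendsto_of_tendsto {x : ℕ → E} {a : E} (h : Tendsto x atTop (𝓝 a)) :
    WeaklyTendsto x a :=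
  weaklyTendsto_iff.2 fun f => (f.continuous.tendsto a).comp h

theorem WeaklyTendsto.map {x : ℕ → E} {a : E} (h : WeaklyTendsto x a) (T : E →L[ℝ] F) :
    WeaklyTendsto (fun n => T (x n)) (T a) :=
  weaklyTendsto_iff.2 fun f => weaklyTendsto_iff.1 h (f.comp T)

theorem WeaklyTendsto.comp_strictMono {x : ℕ → E} {a : E} (h : WeaklyTendsto x a) {ψ : ℕ → ℕ}
    (hψ : StrictMono ψ) : WeaklyTendsto (x ∘ ψ) a :=
  h.comp hψ.tendsto_atTop

theorem WeaklyTendsto.eq_of_tendsto {x : ℕ → E} {a b : E} (h : WeaklyTendsto x a)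
    (hb : Tendsto x atTop (𝓝 b)) : a = b :=
  (NormedSpace.inclusionInDoubleDualLi (𝕜 := ℝ) (E := E)).injective <|
    ContinuousLinearMap.ext fun f =>
      tendsto_nhds_unique (weaklyTendsto_iff.1 h f) ((f.continuous.tendsto b).comp hb)

theorem WeaklyTendsto.exists_norm_le {x : ℕ → E} {a : E} (h : WeaklyTendsto x a) :
    ∃ C, ∀ n, ‖x n‖ ≤ C := by
  have hptwise (f : StrongDual ℝ E) :
      ∃ C, ∀ n, ‖NormedSpace.inclusionInDoubleDual ℝ E (x n) f‖ ≤ C := by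
    obtain ⟨C, hC⟩ := (weaklyTendsto_iff.1 h f).norm.bddAbove_range
    exact ⟨C, fun n => hC ⟨n, rfl⟩⟩
  obtain ⟨C, hC⟩ := banach_steinhaus hptwise
  exact ⟨C, fun n =>
    (NormedSpace.inclusionInDoubleDualLi (𝕜 := ℝ) (E := E)).norm_map (x n) ▸ hC n⟩

theorem WeaklyTendsto.map_isCompactOperator {x : ℕ → E} {a : E} (h : WeaklyTendsto x a)
    {T : E →L[ℝ] F} (hT : IsCompactOperator T) : Tendsto (fun n => T (x n)) atTop (𝓝 (T a)) := by
  obtain ⟨C, hC⟩ := h.exists_norm_le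
  obtain ⟨S, hS, hsub⟩ := hT.image_subset_compact_of_bounded
    (Metric.isBounded_closedBall (x := (0 : E)) (r := C))
  refine hS.tendsto_nhds_of_unique_mapClusterPt
    (Eventually.of_forall fun n => hsub ⟨x n, by simpa using hC n, rfl⟩) fun y _ hy => ?_
  obtain ⟨ψ, hψ, hlim⟩ := hy.tendsto_subseq
  exact (((h.map T).comp_strictMono hψ).eq_of_tendsto hlim).symm

theorem isClosed_toWeakSpace_image {A : Set E} (hA : IsClosed A) (hconv : Convex ℝ A) :
    IsClosed (toWeakSpace ℝ E '' A) := by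
  have h := hconv.toWeakSpace_closure ℝ
  rw [hA.closure_eq] at h
  exact h ▸ isClosed_closure

theorem mem_of_weaklyTendsto {A : Set E} (hA : IsClosed A) (hconv : Convex ℝ A) {x : ℕ → E} {a : E}
    (hx : ∀ᶠ n in atTop, x n ∈ A) (h : WeaklyTendsto x a) : a ∈ A :=
  (toWeakSpace ℝ E).injective.mem_set_image.1 <|
    (isClosed_toWeakSpace_image hA hconv).mem_of_tendsto h
      (hx.mono fun _ hn => Set.mem_image_of_mem _ hn)

theorem exists_forall_abs_sub_lt_of_mem_closure {A : Set E} {a : E}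
    (ha : toWeakSpace ℝ E a ∈ closure (toWeakSpace ℝ E '' A)) (s : Finset (StrongDual ℝ E))
    {ε : ℝ} (hε : 0 < ε) : ∃ x ∈ A, ∀ f ∈ s, |f x - f a| < ε := by
  have hnear : ∀ᶠ y in 𝓝 (toWeakSpace ℝ E a), ∀ f ∈ s,
      |f ((toWeakSpace ℝ E).symm y) - f a| < ε := by
    refine (Filter.eventually_all_finset s).2 fun f _ => ?_
    have hcont : Continuous fun y : WeakSpace ℝ E => |f ((toWeakSpace ℝ E).symm y) - f a| :=
      ((continuous_weakSpace_eval f).sub continuous_const).abs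
    exact hcont.continuousAt.eventually_lt_const (by simpa using hε)
  obtain ⟨_, hy, x, hx, rfl⟩ := mem_closure_iff_nhds.1 ha _ hnear
  exact ⟨x, hx, fun f hf => by simpa using hy f hf⟩

end Weak

section Whitley

variable {E F : Type*} [NormedAddCommGroup E] [NormedSpace ℝ E]
  [NormedAddCommGroup F] [NormedSpace ℝ F]

theorem exists_finset_norm_le_two_mul (V : Submodule ℝ E) [FiniteDimensional ℝ V] :
    ∃ s : Finset (StrongDual ℝ E), ∀ x ∈ V, ∃ f ∈ s, ‖f‖ ≤ 1 ∧ ‖x‖ ≤ 2 * f x := by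
  obtain ⟨t, ht⟩ := (isCompact_sphere (0 : V) 1).elim_finite_subcover
    (fun f : {f : StrongDual ℝ E // ‖f‖ ≤ 1} => {x : V | 1 / 2 < f.1 x})
    (fun f => isOpen_lt continuous_const (f.1.continuous.comp continuous_subtype_val))
    fun x hx => by
      obtain ⟨f, hf, hfx⟩ := exists_dual_vector'' ℝ (x : E)
      have hnorm : ‖(x : E)‖ = 1 := mem_sphere_zero_iff_norm.1 hx
      have hhalf : 1 / 2 < f x := by
        rw [hfx, hnorm]
        exact one_half_lt_one
      exact Set.mem_iUnion.2 ⟨⟨f, hf⟩, hhalf⟩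
  classical
  refine ⟨insert 0 (t.image Subtype.val), fun x hx => ?_⟩
  rcases eq_or_ne x 0 with rfl | hx0
  · exact ⟨0, Finset.mem_insert_self _ _, by simp⟩
  · let y : V := ‖x‖⁻¹ • ⟨x, hx⟩
    have hy : y ∈ Metric.sphere (0 : V) 1 := by
      simp [y, norm_smul, hx0]
    obtain ⟨f, hft, hfy⟩ := Set.mem_iUnion₂.1 (ht hy)
    refine ⟨f, Finset.mem_insert_of_mem (Finset.mem_image_of_mem _ hft), f.2, ?_⟩
    have h : 1 / 2 < ‖x‖⁻¹ * f.1 x := by simpa [y] using hfy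
    rw [inv_mul_eq_div, lt_div_iff₀ (norm_pos_iff.2 hx0)] at h
    linarith

/-- Whitley's construction: each new term of the sequence is chosen weakly close to `a` with respect
to functionals that almost norm the span of the previous ones. -/
theorem exists_seq_tendsto_of_norming {A : Set E} {a : E}
    (ha : toWeakSpace ℝ E a ∈ closure (toWeakSpace ℝ E '' A)) :
    ∃ (x : ℕ → E) (N : Set (StrongDual ℝ E)), (∀ n, x n ∈ A) ∧
      (∀ f ∈ N, Tendsto (fun n => f (x n)) atTop (𝓝 (f a))) ∧
      ∀ z ∈ Submodule.span ℝ (insert a (Set.range x)), ∃ f ∈ N, ‖f‖ ≤ 1 ∧ ‖z‖ ≤ 2 * f z := by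
  classical
  choose N hN using fun D : Finset E =>
    exists_finset_norm_le_two_mul (Submodule.span ℝ (D : Set E))
  choose pick hpickA hpick using fun (D : Finset E) (n : ℕ) =>
    exists_forall_abs_sub_lt_of_mem_closure ha (D.powerset.biUnion N)
      (Nat.one_div_pos_of_nat (n := n))
  obtain ⟨D, hD0, hDsucc⟩ : ∃ D : ℕ → Finset E, D 0 = {a} ∧
      ∀ n, D (n + 1) = insert (pick (D n) n) (D n) :=
    ⟨fun n => Nat.rec {a} (fun n D => insert (pick D n) D) n, rfl, fun _ => rfl⟩
  have hD : Monotone D :=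
    monotone_nat_of_le_succ fun n => hDsucc n ▸ Finset.subset_insert _ _
  refine ⟨fun n => pick (D n) n, ⋃ n, N (D n), fun n => hpickA _ _, fun f hf => ?_, fun z hz => ?_⟩
  · obtain ⟨k, hk⟩ := Set.mem_iUnion.1 hf
    rw [tendsto_iff_dist_tendsto_zero]
    refine squeeze_zero' (Eventually.of_forall fun _ => dist_nonneg) ?_
      tendsto_one_div_add_atTop_nhds_zero_nat
    filter_upwards [eventually_ge_atTop k] with n hn
    exact (hpick (D n) n f
      (Finset.mem_biUnion.2 ⟨D k, Finset.mem_powerset.2 (hD hn), hk⟩)).le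
  · have hsub : insert a (Set.range fun n => pick (D n) n) ⊆
        ⋃ n, (D n : Set E) := by
      rintro _ (rfl | ⟨n, rfl⟩)
      · exact Set.mem_iUnion.2 ⟨0, by simp [hD0]⟩
      · exact Set.mem_iUnion.2 ⟨n + 1, by simp [hDsucc]⟩
    have hspan : Monotone fun n => Submodule.span ℝ (D n : Set E) := fun m n hmn =>
      Submodule.span_mono (Finset.coe_subset.2 (hD hmn))
    have hz' := Submodule.span_mono hsub hz
    rw [Submodule.span_iUnion, Submodule.mem_iSup_of_directed _ hspan.directed_le] at hz'
    obtain ⟨n, hn⟩ := hz'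
    obtain ⟨f, hf, hfz⟩ := hN (D n) z hn
    exact ⟨f, Set.mem_iUnion.2 ⟨n, hf⟩, hfz⟩

theorem eq_zero_of_mem_closure_of_norming {V : Set E} {N : Set (StrongDual ℝ E)}
    (hN : ∀ z ∈ V, ∃ f ∈ N, ‖f‖ ≤ 1 ∧ ‖z‖ ≤ 2 * f z) {z : E} (hz : z ∈ closure V)
    (hzero : ∀ f ∈ N, f z = 0) : z = 0 := by
  refine norm_le_zero_iff.1 (le_of_forall_pos_le_add fun ε hε => ?_)
  obtain ⟨y, hy, hzy⟩ := Metric.mem_closure_iff.1 hz (ε / 3) (by positivity)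
  obtain ⟨f, hf, hf1, hfy⟩ := hN y hy
  have hfyz : f y ≤ dist z y := calc
    f y = f (y - z) := by rw [map_sub, hzero f hf, sub_zero]
    _ ≤ ‖f (y - z)‖ := Real.le_norm_self _
    _ ≤ 1 * ‖y - z‖ := f.le_of_opNorm_le hf1 _
    _ = dist z y := by rw [one_mul, dist_comm, dist_eq_norm]
  have hz3 : ‖z‖ ≤ dist z y + ‖y‖ := by
    simpa only [dist_eq_norm, sub_add_cancel] using norm_add_le (z - y) y
  linarith

theorem Reflexive.isCompact_closure (hE : Reflexive E) {A : Set E} (hA : Bornology.IsBounded A) :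
    IsCompact (closure (toWeakSpace ℝ E '' A)) := by
  refine NormedSpace.isCompact_closure_of_isBounded (𝕜 := ℝ) (X := E) _ ?_ fun y _ => ?_
  · rwa [Set.preimage_image_eq _ (toWeakSpace ℝ E).injective]
  · obtain ⟨x, hx⟩ := hE (WeakDual.toStrongDual y)
    exact ⟨toWeakSpace ℝ E x, hx⟩

theorem Reflexive.exists_weaklyTendsto_of_mem_closure (hE : Reflexive E) {A : Set E}
    (hA : Bornology.IsBounded A) {a : E}
    (ha : toWeakSpace ℝ E a ∈ closure (toWeakSpace ℝ E '' A)) :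
    ∃ x : ℕ → E, (∀ n, x n ∈ A) ∧ WeaklyTendsto x a := by
  obtain ⟨x, N, hxA, hlim, hN⟩ := exists_seq_tendsto_of_norming ha
  refine ⟨x, hxA, (hE.isCompact_closure hA).tendsto_nhds_of_unique_mapClusterPt
    (Eventually.of_forall fun n => subset_closure ⟨x n, hxA n, rfl⟩) fun y _ hy => ?_⟩
  obtain ⟨b, rfl⟩ := (toWeakSpace ℝ E).surjective y
  let V : Submodule ℝ E := Submodule.span ℝ (insert a (Set.range x))
  have hV {z : E} (hz : z ∈ insert a (Set.range x)) : z ∈ V.topologicalClosure :=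
    V.le_topologicalClosure (Submodule.subset_span hz)
  have hbV : b ∈ V.topologicalClosure :=
    (toWeakSpace ℝ E).injective.mem_set_image.1 <|
      (isClosed_toWeakSpace_image V.isClosed_topologicalClosure
        V.topologicalClosure.convex).mem_of_mapClusterPt hy (Eventually.of_forall fun n =>
          Set.mem_image_of_mem _ (hV (Set.mem_insert_of_mem a ⟨n, rfl⟩)))
  have hfb (f : StrongDual ℝ E) (hf : f ∈ N) : f (b - a) = 0 := by
    have hcluster : MapClusterPt (f b) atTop fun n => f (x n) :=
      MapClusterPt.continuousAt_comp (X := WeakSpace ℝ E)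
        (continuous_weakSpace_eval f).continuousAt hy
    obtain ⟨ψ, hψ, hψlim⟩ := hcluster.tendsto_subseq
    rw [map_sub, sub_eq_zero]
    exact tendsto_nhds_unique hψlim ((hlim f hf).comp hψ.tendsto_atTop)
  rw [sub_eq_zero.1 (eq_zero_of_mem_closure_of_norming hN
    (V.topologicalClosure.sub_mem hbV (hV (Set.mem_insert a _))) hfb)]

theorem Reflexive.exists_forall_mem (hE : Reflexive E) {ι : Type*} [Nonempty ι] {T : ι → Set E}
    (hT : ∀ i, Bornology.IsBounded (T i))
    (hclosed : ∀ i (x : ℕ → E) (a : E), (∀ n, x n ∈ T i) → WeaklyTendsto x a → a ∈ T i)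
    (hfin : ∀ s : Finset ι, ∃ a, ∀ i ∈ s, a ∈ T i) : ∃ a, ∀ i, a ∈ T i := by
  classical
  have hcl (i : ι) : IsClosed (toWeakSpace ℝ E '' T i) := by
    refine isClosed_of_closure_subset fun y hy => ?_
    obtain ⟨a, rfl⟩ := (toWeakSpace ℝ E).surjective y
    obtain ⟨x, hx, hlim⟩ := hE.exists_weaklyTendsto_of_mem_closure (hT i) hy
    exact ⟨a, hclosed i x a hx hlim, rfl⟩
  have hcomp (i : ι) : IsCompact (toWeakSpace ℝ E '' T i) :=
    (hcl i).closure_eq ▸ hE.isCompact_closure (hT i)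
  obtain ⟨i₀⟩ := ‹Nonempty ι›
  obtain ⟨_, ⟨a, -, rfl⟩, ha⟩ := (hcomp i₀).inter_iInter_nonempty _ hcl fun s => by
    obtain ⟨a, ha⟩ := hfin (insert i₀ s)
    exact ⟨toWeakSpace ℝ E a, Set.mem_image_of_mem _ (ha _ (Finset.mem_insert_self _ _)),
      Set.mem_iInter₂.2 fun i hi => Set.mem_image_of_mem _ (ha _ (Finset.mem_insert_of_mem hi))⟩
  exact ⟨a, fun i => (toWeakSpace ℝ E).injective.mem_set_image.1 (Set.mem_iInter.1 ha i)⟩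

theorem Reflexive.prod (hE : Reflexive E) (hF : Reflexive F) : Reflexive (E × F) := by
  intro Φ
  obtain ⟨x, hx⟩ := hE (Φ.comp (ContinuousLinearMap.precomp ℝ (ContinuousLinearMap.fst ℝ E F)))
  obtain ⟨y, hy⟩ := hF (Φ.comp (ContinuousLinearMap.precomp ℝ (ContinuousLinearMap.snd ℝ E F)))
  refine ⟨(x, y), ContinuousLinearMap.ext fun f => ?_⟩
  have hfst := DFunLike.congr_fun hx (f.comp (ContinuousLinearMap.inl ℝ E F))
  have hsnd := DFunLike.congr_fun hy (f.comp (ContinuousLinearMap.inr ℝ E F))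
  have hf : f = (f.comp (ContinuousLinearMap.inl ℝ E F)).comp (ContinuousLinearMap.fst ℝ E F) +
      (f.comp (ContinuousLinearMap.inr ℝ E F)).comp (ContinuousLinearMap.snd ℝ E F) := by
    ext p <;> simp [← Prod.zero_eq_mk]
  calc f (x, y) = f (x, 0) + f (0, y) := by rw [← map_add]; simp
    _ = Φ f := by
      conv_rhs => rw [hf, map_add]
      exact congrArg₂ (· + ·) hfst hsnd

end Whitley

section Sublinear

variable {E F : Type*} [AddCommGroup E] [Module ℝ E] [AddCommGroup F] [Module ℝ F]

/-- Sublinear functionals. Homogeneity is required for the factor `0` as well, so that the value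
at `0` is `0`. -/
structure IsSublinear (f : E → ℝ) : Prop where
  map_add_le : ∀ x y, f (x + y) ≤ f x + f y
  map_smul : ∀ t : ℝ, 0 ≤ t → ∀ x, f (t • x) = t * f x

namespace IsSublinear

variable {f g : E → ℝ}

theorem map_zero (hf : IsSublinear f) : f 0 = 0 := by
  simpa using hf.map_smul 0 le_rfl 0

theorem neg_map_neg_le (hf : IsSublinear f) (x : E) : -f (-x) ≤ f x := by
  have h := hf.map_add_le x (-x)
  rw [add_neg_cancel, hf.map_zero] at h
  linarith

theorem add (hf : IsSublinear f) (hg : IsSublinear g) : IsSublinear fun x => f x + g x where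
  map_add_le x y := by linarith [hf.map_add_le x y, hg.map_add_le x y]
  map_smul t ht x := by rw [hf.map_smul t ht, hg.map_smul t ht, mul_add]

theorem const_mul (hf : IsSublinear f) {c : ℝ} (hc : 0 ≤ c) : IsSublinear fun x => c * f x where
  map_add_le x y := by
    rw [← mul_add]
    exact mul_le_mul_of_nonneg_left (hf.map_add_le x y) hc
  map_smul t ht x := by rw [hf.map_smul t ht, mul_left_comm]

theorem comp_linearMap {f : F → ℝ} (hf : IsSublinear f) (T : E →ₗ[ℝ] F) :
    IsSublinear fun x => f (T x) where
  map_add_le x y := by simpa only [map_add] using hf.map_add_le (T x) (T y)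
  map_smul t ht x := by rw [_root_.map_smul, hf.map_smul t ht]

theorem of_linearMap (T : E →ₗ[ℝ] ℝ) : IsSublinear T where
  map_add_le x y := (map_add T x y).le
  map_smul t _ x := _root_.map_smul T t x

theorem convexOn (hf : IsSublinear f) : ConvexOn ℝ Set.univ f :=
  ⟨convex_univ, fun x _ y _ a b ha hb _ => by
    simpa only [hf.map_smul a ha, hf.map_smul b hb, smul_eq_mul] using
      hf.map_add_le (a • x) (b • y)⟩

theorem exists_linearMap_le_eq (hf : IsSublinear f) (d : E) :
    ∃ g : E →ₗ[ℝ] ℝ, (∀ x, g x ≤ f x) ∧ g d = f d := by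
  have hker (t : ℝ) (ht : t • d = 0) : t • f d = 0 := by
    rcases smul_eq_zero.1 ht with rfl | rfl
    · exact zero_smul ℝ _
    · rw [hf.map_zero, smul_zero]
  let f₀ : E →ₗ.[ℝ] ℝ := LinearPMap.mkSpanSingleton' d (f d) hker
  have hf₀ (v : f₀.domain) : f₀ v ≤ f v := by
    obtain ⟨_, hv⟩ := v
    obtain ⟨t, rfl⟩ := Submodule.mem_span_singleton.1 hv
    rw [LinearPMap.mkSpanSingleton'_apply, smul_eq_mul, RingHom.id_apply]
    rcases le_total 0 t with ht | ht
    · exact (hf.map_smul t ht d).ge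
    · have hneg := hf.neg_map_neg_le (t • d)
      rwa [← neg_smul, hf.map_smul _ (neg_nonneg.2 ht), neg_mul, neg_neg] at hneg
  obtain ⟨g, hg, hgle⟩ := exists_extension_of_le_sublinear f₀ f
    (fun t ht x => hf.map_smul t ht.le x) hf.map_add_le hf₀
  exact ⟨g, hgle, (hg ⟨d, Submodule.mem_span_singleton_self d⟩).trans
    (LinearPMap.mkSpanSingleton'_apply_self _ _ _ _)⟩

end IsSublinear

end Sublinear

section Equilibrium

variable {E F : Type*} [NormedAddCommGroup E] [NormedSpace ℝ E]
  [NormedAddCommGroup F] [NormedSpace ℝ F]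

/-- Weak sequential upper semicontinuity of a real functional. -/
def WeaklySeqUSC (g : E → ℝ) : Prop :=
  ∀ (x : ℕ → E) (u : E), WeaklyTendsto x u → ∀ ε > 0, ∀ᶠ n in atTop, g (x n) < g u + ε

theorem WeaklySeqUSC.add {g h : E → ℝ} (hg : WeaklySeqUSC g) (hh : WeaklySeqUSC h) :
    WeaklySeqUSC fun u => g u + h u := fun x u hx ε hε => by
  filter_upwards [hg x u hx _ (half_pos hε), hh x u hx _ (half_pos hε)] with n hgn hhn
  linarith

theorem WeaklySeqUSC.comp {g : F → ℝ} (hg : WeaklySeqUSC g) (T : E →L[ℝ] F) :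
    WeaklySeqUSC fun u => g (T u) := fun _ _ hx => hg _ _ (hx.map T)

theorem weaklySeqUSC_of_tendsto {g : E → ℝ}
    (hg : ∀ (x : ℕ → E) (u : E), WeaklyTendsto x u → Tendsto (fun n => g (x n)) atTop (𝓝 (g u))) :
    WeaklySeqUSC g := fun x u hx _ hε =>
  (hg x u hx).eventually_lt_const (lt_add_of_pos_right _ hε)

theorem WeaklySeqUSC.le_of_weaklyTendsto {M : Set E} {ψ g : E → ℝ} (hg : WeaklySeqUSC g)
    (hψ : ConvexOn ℝ M ψ) (hψcl : ∀ a, IsClosed {p ∈ M | ψ p ≤ a}) {x : ℕ → E} {u : E}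
    (hx : ∀ n, x n ∈ M ∧ ψ (x n) ≤ g (x n)) (h : WeaklyTendsto x u) : u ∈ M ∧ ψ u ≤ g u := by
  have hmem (ε : ℝ) (hε : 0 < ε) : u ∈ M ∧ ψ u ≤ g u + ε := by
    refine mem_of_weaklyTendsto (hψcl (g u + ε)) (hψ.convex_le _) ?_ h
    filter_upwards [hg x u h ε hε] with n hn
    exact ⟨(hx n).1, (hx n).2.trans hn.le⟩
  exact ⟨(hmem 1 one_pos).1, le_of_forall_pos_le_add fun ε hε => (hmem ε hε).2⟩

/-- A Minty companion `f'` of a bifunction `f`, both written as functions of a point `u` and a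
direction `d`: a majorant that is weakly sequentially upper semicontinuous in the point, the target
`u + d` being fixed, and whose slope at `d = 0` is at most that of `f`. -/
structure IsCompanion (f f' : E → E → ℝ) : Prop where
  le : ∀ u d, f u d ≤ f' u d
  usc : ∀ v, WeaklySeqUSC fun u => f' u (v - u)
  slope : ∀ u d, ∀ ε > 0, ∀ᶠ t in 𝓝[>] (0 : ℝ), f' u (t • d) ≤ t * (f u d + ε)

theorem isCompanion_self {f : E → E → ℝ} (hf : ∀ u, IsSublinear (f u))
    (husc : ∀ v, WeaklySeqUSC fun u => f u (v - u)) : IsCompanion f f where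
  le _ _ := le_rfl
  usc := husc
  slope u d ε hε := by
    filter_upwards [self_mem_nhdsWithin] with t ht
    rw [(hf u).map_smul t (Set.mem_Ioi.1 ht).le]
    exact mul_le_mul_of_nonneg_left (by linarith) (Set.mem_Ioi.1 ht).le

theorem IsCompanion.prod {f f' : E → E → ℝ} {g g' : F → F → ℝ} (hf : IsCompanion f f')
    (hg : IsCompanion g g') :
    IsCompanion (fun p d : E × F => f p.1 d.1 + g p.2 d.2)
      (fun p d : E × F => f' p.1 d.1 + g' p.2 d.2) where
  le p d := add_le_add (hf.le _ _) (hg.le _ _)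
  usc q := ((hf.usc q.1).comp (ContinuousLinearMap.fst ℝ E F)).add
    ((hg.usc q.2).comp (ContinuousLinearMap.snd ℝ E F))
  slope p d ε hε := by
    filter_upwards [hf.slope p.1 d.1 _ (half_pos hε), hg.slope p.2 d.2 _ (half_pos hε)]
      with t hft hgt
    rw [Prod.smul_fst, Prod.smul_snd]
    linarith

/-- `p` is an equilibrium on `M` of the bifunction `f`, a function of point and direction, and the
potential `ψ`. -/
def IsEquilibrium (M : Set E) (ψ : E → ℝ) (f : E → E → ℝ) (p : E) : Prop :=
  p ∈ M ∧ ∀ q ∈ M, ψ p ≤ f p (q - p) + ψ q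

variable {M : Set E} {ψ : E → ℝ} {f f' : E → E → ℝ} {p q : E}

theorem le_add_of_eventually_le_add_smul (hψ : ConvexOn ℝ M ψ) (hp : p ∈ M) (hq : q ∈ M) {a : ℝ}
    (h : ∀ ε > 0, ∀ᶠ t in 𝓝[>] (0 : ℝ), ψ p ≤ t * (a + ε) + ψ (p + t • (q - p))) :
    ψ p ≤ a + ψ q := by
  refine le_of_forall_pos_le_add fun ε hε => ?_
  obtain ⟨t, ht, ht0, ht1⟩ := ((h ε hε).and (Ioo_mem_nhdsGT zero_lt_one)).exists
  have hconv := hψ.2 hp hq (sub_nonneg.2 ht1.le) ht0.le (sub_add_cancel 1 t)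
  rw [show (1 - t) • p + t • q = p + t • (q - p) by module, smul_eq_mul, smul_eq_mul] at hconv
  exact le_of_mul_le_mul_left (by linarith : t * ψ p ≤ t * (a + ψ q + ε)) ht0

theorem IsCompanion.le_of_weaklyTendsto (hff' : IsCompanion f f') (hψ : ConvexOn ℝ M ψ)
    (hψcl : ∀ a, IsClosed {p ∈ M | ψ p ≤ a}) {x : ℕ → E}
    (hx : ∀ n, x n ∈ M ∧ ψ (x n) ≤ f' (x n) (q - x n) + ψ q) (h : WeaklyTendsto x p) :
    p ∈ M ∧ ψ p ≤ f' p (q - p) + ψ q :=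
  have hconst : WeaklySeqUSC fun _ : E => ψ q := weaklySeqUSC_of_tendsto fun _ _ _ =>
    tendsto_const_nhds
  ((hff'.usc q).add hconst).le_of_weaklyTendsto hψ hψcl hx h

theorem IsCompanion.isEquilibrium (hff' : IsCompanion f f') (hψ : ConvexOn ℝ M ψ) (hp : p ∈ M)
    (hsol : ∀ q ∈ M, ψ p ≤ f' p (q - p) + ψ q) : IsEquilibrium M ψ f p := by
  refine ⟨hp, fun q hq => le_add_of_eventually_le_add_smul hψ hp hq fun ε hε => ?_⟩
  filter_upwards [hff'.slope p (q - p) ε hε, Ioo_mem_nhdsGT zero_lt_one] with t hslope ht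
  have hqt := hsol _ (hψ.1.add_smul_sub_mem hp hq ⟨ht.1.le, ht.2.le⟩)
  rw [add_sub_cancel_left] at hqt
  exact hqt.trans (add_le_add_left hslope _)

theorem IsEquilibrium.of_inter_mem_nhds (hψ : ConvexOn ℝ M ψ) (hf : IsSublinear (f p)) {U : Set E}
    (hU : U ∈ 𝓝 p) (hsol : IsEquilibrium (M ∩ U) ψ f p) : IsEquilibrium M ψ f p := by
  have hp := hsol.1.1
  refine ⟨hp, fun q hq => le_add_of_eventually_le_add_smul hψ hp hq fun ε hε => ?_⟩
  have hseg : Tendsto (fun t : ℝ => p + t • (q - p)) (𝓝[>] 0) (𝓝 p) :=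
    (Continuous.tendsto' (by fun_prop) _ _ (by simp)).mono_left nhdsWithin_le_nhds
  filter_upwards [hseg hU, Ioo_mem_nhdsGT zero_lt_one] with t htU ht
  have hqt := hsol.2 _ ⟨hψ.1.add_smul_sub_mem hp hq ⟨ht.1.le, ht.2.le⟩, htU⟩
  rw [add_sub_cancel_left, hf.map_smul t ht.1.le] at hqt
  linarith [mul_pos ht.1 hε]

theorem exists_pos_and_apply_sum_le {ι : Type*} [Fintype ι] (hψ : ConvexOn ℝ M ψ) {x : ι → E}
    (hx : ∀ i, x i ∈ M) {w : ι → ℝ} (hw : w ∈ stdSimplex ℝ ι) :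
    ∃ i, 0 < w i ∧ ψ (∑ j, w j • x j) ≤ ψ (x i) := by
  classical
  have hsum : ∑ i with w i ≠ 0, w i = 1 := (Finset.sum_filter_ne_zero _).trans hw.2
  obtain ⟨i, hi, hle⟩ := hψ.exists_ge_of_centerMass (t := {i | w i ≠ 0}) (fun i _ => hw.1 i)
    (hsum ▸ zero_lt_one) fun i _ => hx i
  rw [Finset.centerMass_filter_ne_zero, Finset.centerMass_eq_of_sum_1 _ _ hw.2] at hle
  exact ⟨i, (hw.1 i).lt_of_ne' (Finset.mem_filter.1 hi).2, hle⟩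

theorem IsCompanion.exists_forall_le_of_finite (hff' : IsCompanion f f')
    (hf : ∀ u, IsSublinear (f u)) (hψ : ConvexOn ℝ M ψ) (hψcl : ∀ a, IsClosed {p ∈ M | ψ p ≤ a})
    {ι : Type*} [Finite ι] [Nonempty ι] {x : ι → E} (hx : ∀ i, x i ∈ M) :
    ∃ p, ∀ i, p ∈ M ∧ ψ p ≤ f' p (x i - p) + ψ (x i) := by
  cases nonempty_fintype ι
  let comb (w : ι → ℝ) : E := ∑ i, w i • x i
  have hcomb : Continuous comb :=
    continuous_finsetSum _ fun i _ => (continuous_apply i).smul continuous_const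
  let T (i : ι) : Set (ι → ℝ) :=
    {w | comb w ∈ M ∧ ψ (comb w) ≤ f' (comb w) (x i - comb w) + ψ (x i)}
  have hT (i : ι) : IsClosed (T i) := IsSeqClosed.isClosed fun v w hv hvw =>
    hff'.le_of_weaklyTendsto hψ hψcl hv (weaklyTendsto_of_tendsto ((hcomb.tendsto w).comp hvw))
  have hcover (w : ι → ℝ) (hw : w ∈ stdSimplex ℝ ι) : ∃ i, 0 < w i ∧ w ∈ T i := by
    have hmem : comb w ∈ M := hψ.1.sum_mem (fun i _ => hw.1 i) hw.2 fun i _ => hx i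
    have hconv : ConvexOn ℝ M fun q => f (comb w) (q - comb w) + ψ q := by
      refine ConvexOn.add ?_ hψ
      simpa only [sub_eq_neg_add, Function.comp_def] using
        ((hf (comb w)).convexOn.translate_right (-comb w)).subset (Set.subset_univ M) hψ.1
    obtain ⟨i, hi, hle⟩ := exists_pos_and_apply_sum_le hconv hx hw
    refine ⟨i, hi, hmem, ?_⟩
    calc ψ (comb w) = f (comb w) (comb w - comb w) + ψ (comb w) := by
          rw [sub_self, (hf _).map_zero, zero_add]
      _ ≤ f (comb w) (x i - comb w) + ψ (x i) := hle
      _ ≤ f' (comb w) (x i - comb w) + ψ (x i) := add_le_add_left (hff'.le _ _) _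
  obtain ⟨w, -, h⟩ := exists_mem_stdSimplex_forall_mem hT hcover
  exact ⟨comb w, h⟩

theorem Reflexive.exists_isEquilibrium (hE : Reflexive E) (hMne : M.Nonempty)
    (hMb : Bornology.IsBounded M) (hff' : IsCompanion f f') (hf : ∀ u, IsSublinear (f u))
    (hψ : ConvexOn ℝ M ψ) (hψcl : ∀ a, IsClosed {p ∈ M | ψ p ≤ a}) :
    ∃ p, IsEquilibrium M ψ f p := by
  have : Nonempty M := hMne.to_subtype
  let T (q : M) : Set E := {p | p ∈ M ∧ ψ p ≤ f' p (q - p) + ψ q}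
  have hfin (s : Finset M) : ∃ p, ∀ q ∈ s, p ∈ T q := by
    rcases s.eq_empty_or_nonempty with rfl | hs
    · exact ⟨0, by simp⟩
    · have := hs.to_subtype
      obtain ⟨p, hp⟩ := hff'.exists_forall_le_of_finite hf hψ hψcl (x := fun q : s => (q : E))
        fun q => q.1.2
      exact ⟨p, fun q hq => hp ⟨q, hq⟩⟩
  obtain ⟨p, hp⟩ := hE.exists_forall_mem (T := T) (fun q => hMb.subset fun p hp => hp.1)
    (fun q x a hx hxa => hff'.le_of_weaklyTendsto hψ hψcl hx hxa) hfin
  exact ⟨p, hff'.isEquilibrium hψ (hp (Classical.arbitrary M)).1 fun q hq => (hp ⟨q, hq⟩).2⟩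

theorem Reflexive.exists_isEquilibrium_of_norm_lt (hE : Reflexive E) (hff' : IsCompanion f f')
    (hf : ∀ u, IsSublinear (f u)) (hψ : ConvexOn ℝ M ψ)
    (hψcl : ∀ a, IsClosed {p ∈ M | ψ p ≤ a}) {ρ : ℝ}
    (hne : (M ∩ Metric.closedBall 0 ρ).Nonempty)
    (hρ : ∀ p, IsEquilibrium (M ∩ Metric.closedBall 0 ρ) ψ f p → ‖p‖ < ρ) :
    ∃ p, IsEquilibrium M ψ f p := by
  have hcl (a : ℝ) : IsClosed {p ∈ M ∩ Metric.closedBall 0 ρ | ψ p ≤ a} := by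
    have h := (hψcl a).inter (Metric.isClosed_closedBall (x := (0 : E)) (ε := ρ))
    rwa [← Set.inter_ofPred_eq_sep, Set.inter_right_comm] at h
  obtain ⟨p, hp⟩ := hE.exists_isEquilibrium hne
    (Metric.isBounded_closedBall.subset Set.inter_subset_right) hff' hf
    (hψ.subset Set.inter_subset_left (hψ.1.inter (convex_closedBall 0 ρ))) hcl
  exact ⟨p, hp.of_inter_mem_nhds hψ (hf p)
    (Metric.closedBall_mem_nhds_of_mem (mem_ball_zero_iff.2 (hρ p hp)))⟩

end Equilibrium

section Clarke

variable {E : Type*} [NormedAddCommGroup E] [NormedSpace ℝ E] {h : E → ℝ} {x : E}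

theorem tendsto_fst_add_snd_smul (x y : E) :
    Tendsto (fun p : E × ℝ => p.1 + p.2 • y) (𝓝 x ×ˢ 𝓝[>] (0 : ℝ)) (𝓝 x) := by
  have hcont : Continuous fun p : E × ℝ => p.1 + p.2 • y := by fun_prop
  have hlim := hcont.tendsto' (x, 0) x (by simp)
  rw [nhds_prod_eq] at hlim
  exact hlim.mono_left (Filter.prod_mono le_rfl nhdsWithin_le_nhds)

theorem eventually_snd_pos {α : Type*} (l : Filter α) :
    ∀ᶠ p : α × ℝ in l ×ˢ 𝓝[>] (0 : ℝ), 0 < p.2 :=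
  tendsto_snd.eventually self_mem_nhdsWithin

section LipschitzOnWith

variable {C : ℝ≥0} {U : Set E} (hU : U ∈ 𝓝 x) (hLip : LipschitzOnWith C h U)
include hU hLip

theorem eventually_abs_differenceQuotient_le (y : E) :
    ∀ᶠ p : E × ℝ in 𝓝 x ×ˢ 𝓝[>] (0 : ℝ), |(h (p.1 + p.2 • y) - h p.1) / p.2| ≤ C * ‖y‖ := by
  filter_upwards [(tendsto_fst_add_snd_smul x y).eventually hU, tendsto_fst.eventually hU,
    eventually_snd_pos (𝓝 x)] with p hpy hp hpos
  have hdist := hLip.dist_le_mul _ hpy _ hp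
  rw [Real.dist_eq, dist_eq_norm, add_sub_cancel_left, norm_smul,
    Real.norm_of_nonneg hpos.le] at hdist
  rw [abs_div, abs_of_pos hpos, div_le_iff₀ hpos]
  linarith

theorem clarkeDeriv_le_of_eventually_le {y : E} {a : ℝ}
    (ha : ∀ᶠ p : E × ℝ in 𝓝 x ×ˢ 𝓝[>] (0 : ℝ), (h (p.1 + p.2 • y) - h p.1) / p.2 ≤ a) :
    clarkeDeriv h x y ≤ a := by
  refine limsup_le_of_le (IsBoundedUnder.isCoboundedUnder_le ⟨-(C * ‖y‖), ?_⟩) ha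
  exact eventually_map.2 <|
    (eventually_abs_differenceQuotient_le hU hLip y).mono fun p hp => (abs_le.1 hp).1

theorem eventually_lt_of_clarkeDeriv_lt {y : E} {a : ℝ} (ha : clarkeDeriv h x y < a) :
    ∀ᶠ p : E × ℝ in 𝓝 x ×ˢ 𝓝[>] (0 : ℝ), (h (p.1 + p.2 • y) - h p.1) / p.2 < a :=
  eventually_lt_of_limsup_lt ha ⟨C * ‖y‖, eventually_map.2 <|
    (eventually_abs_differenceQuotient_le hU hLip y).mono fun _ hp => (abs_le.1 hp).2⟩

theorem abs_clarkeDeriv_le (y : E) : |clarkeDeriv h x y| ≤ C * ‖y‖ := by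
  have hbound := eventually_abs_differenceQuotient_le hU hLip y
  refine abs_le.2 ⟨?_, clarkeDeriv_le_of_eventually_le hU hLip
    (hbound.mono fun _ hp => (abs_le.1 hp).2)⟩
  by_contra! hlt
  obtain ⟨p, hplt, hp⟩ := ((eventually_lt_of_clarkeDeriv_lt hU hLip hlt).and hbound).exists
  exact (abs_le.1 hp).1.not_gt hplt

theorem clarkeDeriv_add_le (y w : E) :
    clarkeDeriv h x (y + w) ≤ clarkeDeriv h x y + clarkeDeriv h x w := by
  refine le_of_forall_pos_le_add fun ε hε => clarkeDeriv_le_of_eventually_le hU hLip ?_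
  have hshift : Tendsto (fun p : E × ℝ => (p.1 + p.2 • w, p.2)) (𝓝 x ×ˢ 𝓝[>] (0 : ℝ))
      (𝓝 x ×ˢ 𝓝[>] (0 : ℝ)) := (tendsto_fst_add_snd_smul x w).prodMk tendsto_snd
  filter_upwards [hshift.eventually (eventually_lt_of_clarkeDeriv_lt hU hLip
      (lt_add_of_pos_right (clarkeDeriv h x y) (half_pos hε))),
    eventually_lt_of_clarkeDeriv_lt hU hLip
      (lt_add_of_pos_right (clarkeDeriv h x w) (half_pos hε))] with p hy hw
  calc (h (p.1 + p.2 • (y + w)) - h p.1) / p.2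
      = (h (p.1 + p.2 • w + p.2 • y) - h (p.1 + p.2 • w)) / p.2 +
          (h (p.1 + p.2 • w) - h p.1) / p.2 := by
        rw [smul_add, add_left_comm, add_comm (p.2 • y), ← add_div, sub_add_sub_cancel]
    _ ≤ clarkeDeriv h x y + clarkeDeriv h x w + ε := by linarith

theorem clarkeDeriv_smul_le (y : E) {s : ℝ} (hs : 0 < s) :
    clarkeDeriv h x (s • y) ≤ s * clarkeDeriv h x y := by
  refine le_of_forall_pos_le_add fun ε hε => clarkeDeriv_le_of_eventually_le hU hLip ?_
  have hscale : Tendsto (fun p : E × ℝ => (p.1, s * p.2)) (𝓝 x ×ˢ 𝓝[>] (0 : ℝ))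
      (𝓝 x ×ˢ 𝓝[>] (0 : ℝ)) := by
    refine tendsto_fst.prodMk (tendsto_nhdsWithin_iff.2 ⟨?_, ?_⟩)
    · have hmul : Tendsto (fun t : ℝ => s * t) (𝓝[>] 0) (𝓝 0) :=
        (Continuous.tendsto' (by fun_prop) _ _ (mul_zero s)).mono_left nhdsWithin_le_nhds
      exact hmul.comp tendsto_snd
    · exact (eventually_snd_pos (𝓝 x)).mono fun p hp => mul_pos hs hp
  filter_upwards [hscale.eventually (eventually_lt_of_clarkeDeriv_lt hU hLip
    (lt_add_of_pos_right (clarkeDeriv h x y) (div_pos hε hs))), eventually_snd_pos (𝓝 x)]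
    with p hp hpos
  calc (h (p.1 + p.2 • s • y) - h p.1) / p.2
      = s * ((h (p.1 + (s * p.2) • y) - h p.1) / (s * p.2)) := by
        rw [smul_smul, mul_comm p.2 s]
        field_simp
    _ ≤ s * (clarkeDeriv h x y + ε / s) := mul_le_mul_of_nonneg_left hp.le hs.le
    _ = s * clarkeDeriv h x y + ε := by rw [mul_add, mul_div_cancel₀ _ hs.ne']

theorem isSublinear_clarkeDeriv_of_lipschitzOnWith : IsSublinear (clarkeDeriv h x) where
  map_add_le := clarkeDeriv_add_le hU hLip
  map_smul s hs y := by
    rcases hs.eq_or_lt with rfl | hs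
    · have hzero := abs_clarkeDeriv_le hU hLip 0
      rw [norm_zero, mul_zero] at hzero
      rw [zero_smul, zero_mul]
      exact abs_nonpos_iff.1 hzero
    · refine le_antisymm (clarkeDeriv_smul_le hU hLip y hs) ?_
      have hinv := clarkeDeriv_smul_le hU hLip (s • y) (inv_pos.2 hs)
      rwa [inv_smul_smul₀ hs.ne', inv_mul_eq_div, le_div_iff₀' hs] at hinv

theorem clarkeDeriv_le_add_mul_norm_sub (y w : E) :
    clarkeDeriv h x y ≤ clarkeDeriv h x w + C * ‖y - w‖ := by
  have hadd := clarkeDeriv_add_le hU hLip w (y - w)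
  rw [add_sub_cancel] at hadd
  linarith [(abs_le.1 (abs_clarkeDeriv_le hU hLip (y - w))).2]

end LipschitzOnWith

variable (hh : LocallyLipschitz h)
include hh

theorem isSublinear_clarkeDeriv (x : E) : IsSublinear (clarkeDeriv h x) := by
  obtain ⟨C, U, hU, hLip⟩ := hh x
  exact isSublinear_clarkeDeriv_of_lipschitzOnWith hU hLip

theorem continuous_clarkeDeriv (x : E) : Continuous (clarkeDeriv h x) := by
  obtain ⟨C, U, hU, hLip⟩ := hh x
  exact (LipschitzWith.of_le_add_mul C fun y w => by
    rw [dist_eq_norm]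
    exact clarkeDeriv_le_add_mul_norm_sub hU hLip y w).continuous

theorem eventually_clarkeDeriv_lt {ι : Type*} {l : Filter ι} {u w : ι → E} {y : E}
    (hu : Tendsto u l (𝓝 x)) (hw : Tendsto w l (𝓝 y)) {a : ℝ} (ha : clarkeDeriv h x y < a) :
    ∀ᶠ n in l, clarkeDeriv h (u n) (w n) < a := by
  obtain ⟨C, U, hU, hLip⟩ := hh x
  obtain ⟨b, hb, hba⟩ := exists_between ha
  have hbase : ∀ᶠ z in 𝓝 x, U ∈ 𝓝 z ∧ clarkeDeriv h z y ≤ b := by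
    obtain ⟨p, hp, q, hq, hpq⟩ :=
      eventually_prod_iff.1 (eventually_lt_of_clarkeDeriv_lt hU hLip hb)
    filter_upwards [eventually_mem_nhds_iff.2 hU, eventually_eventually_nhds.2 hp] with z hzU hz
    exact ⟨hzU, clarkeDeriv_le_of_eventually_le hzU hLip
      (eventually_prod_iff.2 ⟨p, hz, q, hq, fun hp _ hq => (hpq hp hq).le⟩)⟩
  have hdir : Tendsto (fun n => C * ‖w n - y‖) l (𝓝 0) := by
    simpa only [mul_zero] using (tendsto_iff_norm_sub_tendsto_zero.1 hw).const_mul (C : ℝ)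
  filter_upwards [hu.eventually hbase, hdir.eventually_lt_const (sub_pos.2 hba)] with n hn hwn
  linarith [clarkeDeriv_le_add_mul_norm_sub hn.1 hLip (w n) y, hn.2]

theorem eventually_mul_clarkeDeriv_lt {ι : Type*} {l : Filter ι} {u w : ι → E} {k : ι → ℝ} {y : E}
    {c : ℝ} (hk : Tendsto k l (𝓝 c)) (hk0 : ∀ n, 0 ≤ k n) (hc : 0 ≤ c) (hu : Tendsto u l (𝓝 x))
    (hw : Tendsto w l (𝓝 y)) {ε : ℝ} (hε : 0 < ε) :
    ∀ᶠ n in l, k n * clarkeDeriv h (u n) (w n) < c * clarkeDeriv h x y + ε := by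
  have hδ : 0 < ε / (c + 1) := by positivity
  have hcδ : c * (ε / (c + 1)) < ε := by
    rw [← mul_div_assoc, div_lt_iff₀ (by positivity)]
    linarith
  have hlim := hk.mul_const (clarkeDeriv h x y + ε / (c + 1))
  filter_upwards [hlim.eventually_lt_const
      (show _ < c * clarkeDeriv h x y + ε by rw [mul_add]; linarith),
    eventually_clarkeDeriv_lt hh hu hw (lt_add_of_pos_right _ hδ)] with n hkn hDn
  exact (mul_le_mul_of_nonneg_left hDn.le (hk0 n)).trans_lt hkn

theorem exists_mem_clarkeSubdiff_eq (x d : E) :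
    ∃ ξ ∈ clarkeSubdiff h x, ξ d = clarkeDeriv h x d := by
  obtain ⟨C, U, hU, hLip⟩ := hh x
  obtain ⟨g, hgle, hgd⟩ := (isSublinear_clarkeDeriv hh x).exists_linearMap_le_eq d
  have hg (y : E) : g y ≤ C * ‖y‖ :=
    (hgle y).trans (abs_le.1 (abs_clarkeDeriv_le hU hLip y)).2
  refine ⟨g.mkContinuous C fun y => abs_le.2 ⟨?_, hg y⟩, hgle, hgd⟩
  have hneg := hg (-y)
  rw [map_neg, norm_neg] at hneg
  linarith

end Clarke

section Operators

variable {E Z : Type*} [NormedAddCommGroup E] [NormedSpace ℝ E]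
  [NormedAddCommGroup Z] [NormedSpace ℝ Z]

theorem ConcaveRelaxedDissipative.apply_nonpos {A : E → Set (StrongDual ℝ E)}
    (hA : ConcaveRelaxedDissipative A) {x y : E} {ζx ζy : StrongDual ℝ E} (hx : ζx ∈ A x)
    (hy : ζy ∈ A y) : (ζy - ζx) (y - x) ≤ 0 := by
  obtain ⟨β, hβ, hβ0, h⟩ := hA
  have hswap : (ζx - ζy) (x - y) = (ζy - ζx) (y - x) := by
    rw [← neg_sub ζy, ← neg_sub y, map_neg, neg_apply, neg_neg]
  have hxy := h x y ζx hx ζy hy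
  have hyx := h y x ζy hy ζx hx
  have hmid := hβ.2 (Set.mem_univ (y - x)) (Set.mem_univ (x - y))
    one_half_pos.le one_half_pos.le (add_halves (1 : ℝ))
  have hmidpoint : (1 / 2 : ℝ) • (y - x) + (1 / 2 : ℝ) • (x - y) = 0 := by module
  rw [hmidpoint, smul_eq_mul, smul_eq_mul] at hmid
  linarith

/-- The bifunction, in a point `u` and a direction `d`, of the hemivariational inequality with
operator `A` and potential `h ∘ γ` weighted by `c`. -/
noncomputable def hemivariationalForm (A : E → StrongDual ℝ E) (c : E → ℝ) (γ : E →L[ℝ] Z)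
    (h : Z → ℝ) (u d : E) : ℝ :=
  -A u d + c u * clarkeDeriv h (γ u) (γ d)

variable {A : E → StrongDual ℝ E} {c : E → ℝ} {γ : E →L[ℝ] Z} {h : Z → ℝ}

theorem isSublinear_hemivariationalForm (hh : LocallyLipschitz h) {u : E} (hc : 0 ≤ c u) :
    IsSublinear (hemivariationalForm A c γ h u) :=
  (IsSublinear.of_linearMap (-A u).toLinearMap).add
    (((isSublinear_clarkeDeriv hh (γ u)).comp_linearMap γ.toLinearMap).const_mul hc)

theorem hemivariationalForm_zero (hh : LocallyLipschitz h) (u : E) :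
    hemivariationalForm A c γ h u 0 = 0 := by
  rw [hemivariationalForm, map_zero, map_zero, (isSublinear_clarkeDeriv hh _).map_zero, mul_zero,
    neg_zero, add_zero]

theorem OpCond1.weaklySeqUSC (hA : OpCond1 A) (v : E) : WeaklySeqUSC fun u => -A u (v - u) := by
  intro x u hx ε hε
  have hlt : ((A u (v - u) - ε : ℝ) : EReal) <
      liminf (fun n => ((A (x n) (v - x n) : ℝ) : EReal)) atTop :=
    (EReal.coe_lt_coe_iff.2 (sub_lt_self _ hε)).trans_le (hA v u x hx)
  filter_upwards [eventually_lt_of_lt_liminf hlt] with n hn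
  linarith [EReal.coe_lt_coe_iff.1 hn]

theorem weaklySeqUSC_neg_apply_sub (f : StrongDual ℝ E) (v : E) :
    WeaklySeqUSC fun u => -f (v - u) :=
  weaklySeqUSC_of_tendsto fun x u hx => by
    simp only [map_sub]
    exact (tendsto_const_nhds.sub (weaklyTendsto_iff.1 hx f)).neg

theorem Hemicontinuous.eventually_neg_lt (hA : Hemicontinuous A) (u d : E) {ε : ℝ} (hε : 0 < ε) :
    ∀ᶠ t in 𝓝[>] (0 : ℝ), -A (u + t • d) d < -A u d + ε := by
  have hlim := hA u (u + d) d
  rw [add_sub_cancel_left] at hlim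
  exact hlim.neg.eventually_lt_const (lt_add_of_pos_right _ hε)

variable (hh : LocallyLipschitz h) (hγ : IsCompactOperator γ) (hc : ∀ u, 0 ≤ c u)
  (hcw : ∀ (u : E) (x : ℕ → E), WeaklyTendsto x u → Tendsto (fun n => c (x n)) atTop (𝓝 (c u)))

include hh hγ in
theorem weaklySeqUSC_const_mul_clarkeDeriv_sub (k : ℝ) (z : Z) (v : E) :
    WeaklySeqUSC fun u => k * clarkeDeriv h z (γ (u - v)) :=
  weaklySeqUSC_of_tendsto fun x u hx => by
    simp only [map_sub]
    exact (((continuous_clarkeDeriv hh z).tendsto _).comp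
      ((hx.map_isCompactOperator hγ).sub tendsto_const_nhds)).const_mul k

include hh hγ hc hcw in
theorem weaklySeqUSC_mul_clarkeDeriv (v : E) :
    WeaklySeqUSC fun u => c u * clarkeDeriv h (γ u) (γ (v - u)) := by
  intro x u hx ε hε
  have hγx := hx.map_isCompactOperator hγ
  refine eventually_mul_clarkeDeriv_lt hh (hcw u x hx) (fun n => hc _) (hc u) hγx ?_ hε
  simp only [map_sub]
  exact tendsto_const_nhds.sub hγx

include hh hγ hc hcw

theorem OpCond1.isCompanion (hA : OpCond1 A) :
    IsCompanion (hemivariationalForm A c γ h) (hemivariationalForm A c γ h) :=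
  isCompanion_self (fun u => isSublinear_hemivariationalForm hh (hc u)) fun v =>
    (hA.weaklySeqUSC v).add (weaklySeqUSC_mul_clarkeDeriv hh hγ hc hcw v)

theorem OpCond2.isCompanion (hA : OpCond2 A) :
    IsCompanion (hemivariationalForm A c γ h)
      fun u d => -A (u + d) d + c u * clarkeDeriv h (γ u) (γ d) where
  le u d := by
    have hdiss := hA.2.apply_nonpos (x := u) (y := u + d) rfl rfl
    rw [add_sub_cancel_left, sub_apply] at hdiss
    rw [hemivariationalForm]
    linarith
  usc v := by
    simpa only [add_sub_cancel] using
      (weaklySeqUSC_neg_apply_sub (A v) v).add (weaklySeqUSC_mul_clarkeDeriv hh hγ hc hcw v)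
  slope u d ε hε := by
    filter_upwards [hA.1.eventually_neg_lt u d hε, self_mem_nhdsWithin] with t hAt ht
    have ht0 : 0 ≤ t := (Set.mem_Ioi.1 ht).le
    calc -A (u + t • d) (t • d) + c u * clarkeDeriv h (γ u) (γ (t • d))
        = t * (-A (u + t • d) d + c u * clarkeDeriv h (γ u) (γ d)) := by
          rw [map_smul, map_smul, (isSublinear_clarkeDeriv hh _).map_smul t ht0, smul_eq_mul]
          ring
      _ ≤ t * (hemivariationalForm A c γ h u d + ε) := by
          refine mul_le_mul_of_nonneg_left ?_ ht0
          rw [hemivariationalForm]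
          linarith

theorem OpCond3.isCompanion (hA : OpCond3 A c γ h) :
    IsCompanion (hemivariationalForm A c γ h)
      fun u d => -A (u + d) d + -c (u + d) * clarkeDeriv h (γ (u + d)) (γ (-d)) where
  le u d := by
    obtain ⟨ξ, hξ, hξd⟩ := exists_mem_clarkeSubdiff_eq hh (γ u) (γ d)
    obtain ⟨η, hη, hηd⟩ := exists_mem_clarkeSubdiff_eq hh (γ (u + d)) (γ (-d))
    have hdiss := hA.2.apply_nonpos (x := u) (y := u + d) ⟨ξ, hξ, rfl⟩ ⟨η, hη, rfl⟩
    rw [map_neg, map_neg] at hηd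
    simp only [add_sub_cancel_left, sub_apply, smul_apply,
      ContinuousLinearMap.comp_apply, smul_eq_mul, hξd] at hdiss
    rw [hemivariationalForm, map_neg, ← hηd]
    linarith
  usc v := by
    simpa only [add_sub_cancel, neg_sub] using (weaklySeqUSC_neg_apply_sub (A v) v).add
      (weaklySeqUSC_const_mul_clarkeDeriv_sub hh hγ (-c v) (γ v) v)
  slope u d ε hε := by
    have hseg : Tendsto (fun t : ℝ => u + t • d) (𝓝[>] 0) (𝓝 u) :=
      (Continuous.tendsto' (by fun_prop) _ _ (by simp)).mono_left nhdsWithin_le_nhds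
    have hcseg : Tendsto (fun t : ℝ => c (u + t • d)) (𝓝[>] 0) (𝓝 (c u)) :=
      tendsto_of_seq_tendsto fun t ht => hcw u _ (weaklyTendsto_of_tendsto (hseg.comp ht))
    filter_upwards [hA.1.eventually_neg_lt u d (half_pos hε),
      eventually_mul_clarkeDeriv_lt hh hcseg (fun t => hc _) (hc u)
        ((γ.continuous.tendsto u).comp hseg) (tendsto_const_nhds (x := γ d)) (half_pos hε),
      self_mem_nhdsWithin] with t hAt hDt ht
    have ht0 : 0 ≤ t := (Set.mem_Ioi.1 ht).le
    have hsub := isSublinear_clarkeDeriv hh (γ (u + t • d))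
    have hneg := mul_le_mul_of_nonneg_left (hsub.neg_map_neg_le (γ d)) (hc (u + t • d))
    rw [Function.comp_apply] at hDt
    calc -A (u + t • d) (t • d) +
          -c (u + t • d) * clarkeDeriv h (γ (u + t • d)) (γ (-(t • d)))
        = t * (-A (u + t • d) d +
            c (u + t • d) * -clarkeDeriv h (γ (u + t • d)) (-γ d)) := by
          rw [← smul_neg, map_smul, map_smul, map_neg, hsub.map_smul t ht0, smul_eq_mul]
          ring
      _ ≤ t * (hemivariationalForm A c γ h u d + ε) := by
          refine mul_le_mul_of_nonneg_left ?_ ht0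
          rw [hemivariationalForm]
          linarith

theorem exists_isCompanion_hemivariationalForm
    (hA : OpCond1 A ∨ OpCond2 A ∨ OpCond3 A c γ h) :
    ∃ f', IsCompanion (hemivariationalForm A c γ h) f' := by
  rcases hA with hA | hA | hA
  · exact ⟨_, hA.isCompanion hh hγ hc hcw⟩
  · exact ⟨_, hA.isCompanion hh hγ hc hcw⟩
  · exact ⟨_, hA.isCompanion hh hγ hc hcw⟩

end Operators

section Energy

variable {E : Type*} {φ : E → EReal} {B : E → ℝ} {D : Set E} {x : E}

theorem coe_toReal_of_mem_effDomain (hbot : ∀ x, φ x ≠ ⊥) (hx : x ∈ effDomain φ) :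
    ((φ x).toReal : EReal) = φ x :=
  EReal.coe_toReal (ne_of_lt hx) (hbot x)

/-- The sum of `B` and `φ` as a real function. It has the intended value only on the effective
domain of `φ`, the real part of `⊤` being `0`. -/
noncomputable def energy (B : E → ℝ) (φ : E → EReal) (x : E) : ℝ :=
  B x + (φ x).toReal

theorem mem_effDomain_and_energy_le_iff (hbot : ∀ x, φ x ≠ ⊥) {a : ℝ} :
    x ∈ effDomain φ ∧ energy B φ x ≤ a ↔ (B x : EReal) + φ x ≤ a := by
  constructor
  · rintro ⟨hx, hle⟩
    rw [← coe_toReal_of_mem_effDomain hbot hx, ← EReal.coe_add]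
    exact EReal.coe_le_coe_iff.2 hle
  · intro hle
    have hx : x ∈ effDomain φ := by
      refine (lt_top_iff_ne_top (a := φ x)).2 fun htop => ?_
      rw [htop, EReal.coe_add_top] at hle
      exact hle.not_gt (EReal.coe_lt_top a)
    rw [← coe_toReal_of_mem_effDomain hbot hx, ← EReal.coe_add] at hle
    exact ⟨hx, EReal.coe_le_coe_iff.1 hle⟩

theorem isClosed_sublevel_energy [TopologicalSpace E] (hD : IsClosed D) (hbot : ∀ x, φ x ≠ ⊥)
    (hφ : LowerSemicontinuous φ) (hB : LowerSemicontinuousOn B D) (a : ℝ) :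
    IsClosed {x ∈ D ∩ effDomain φ | energy B φ x ≤ a} := by
  have hsum : LowerSemicontinuousOn (fun x => (B x : EReal) + φ x) D :=
    (continuous_coe_real_ereal.comp_lowerSemicontinuousOn hB
      EReal.coe_strictMono.monotone).add' (hφ.lowerSemicontinuousOn D) fun x _ =>
        EReal.continuousAt_add (Or.inr (hbot x)) (Or.inl (EReal.coe_ne_bot _))
  obtain ⟨V, hV, hDV⟩ := lowerSemicontinuousOn_iff_preimage_Iic.1 hsum a
  have hsublevel : {x ∈ D ∩ effDomain φ | energy B φ x ≤ a} = D ∩ V := by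
    rw [← hDV]
    ext x
    exact and_assoc.trans (and_congr_right fun _ => mem_effDomain_and_energy_le_iff hbot)
  rw [hsublevel]
  exact hD.inter hV

variable [NormedAddCommGroup E] [NormedSpace ℝ E]

theorem convexOn_toReal (hbot : ∀ x, φ x ≠ ⊥) (hφ : ERealConvex φ) :
    ConvexOn ℝ (effDomain φ) fun x => (φ x).toReal := by
  have hle (x : E) (hx : x ∈ effDomain φ) (y : E) (hy : y ∈ effDomain φ) (a b : ℝ) (ha : 0 ≤ a)
      (hb : 0 ≤ b) (hab : a + b = 1) :
      φ (a • x + b • y) ≤ ((a * (φ x).toReal + b * (φ y).toReal : ℝ) : EReal) := by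
    obtain rfl : b = 1 - a := by linarith
    have hconv := hφ x y a ha (by linarith)
    rw [← coe_toReal_of_mem_effDomain hbot hx, ← coe_toReal_of_mem_effDomain hbot hy] at hconv
    exact_mod_cast hconv
  have hdom : Convex ℝ (effDomain φ) := fun x hx y hy a b ha hb hab =>
    (hle x hx y hy a b ha hb hab).trans_lt (EReal.coe_lt_top _)
  refine ⟨hdom, fun x hx y hy a b ha hb hab => ?_⟩
  have hxy := hle x hx y hy a b ha hb hab
  rw [← coe_toReal_of_mem_effDomain hbot (hdom hx hy ha hb hab)] at hxy
  exact EReal.coe_le_coe_iff.1 hxy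

theorem convexOn_energy (hbot : ∀ x, φ x ≠ ⊥) (hφ : ERealConvex φ) (hB : ConvexOn ℝ D B) :
    ConvexOn ℝ (D ∩ effDomain φ) (energy B φ) := by
  have hreal := convexOn_toReal hbot hφ
  have hconv := hB.1.inter hreal.1
  exact (hB.subset Set.inter_subset_left hconv).add (hreal.subset Set.inter_subset_right hconv)

theorem exists_sub_mul_norm_sub_le {s : Set E} {g : E → ℝ} (hg : ConvexOn ℝ s g) {x₀ : E}
    (hx₀ : x₀ ∈ s) {c : ℝ} (hc : ∀ᶠ x in 𝓝[s] x₀, c < g x) :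
    ∃ k ≥ 0, ∀ x ∈ s, c - k * ‖x - x₀‖ ≤ g x := by
  obtain ⟨δ, hδ, hball⟩ := Metric.mem_nhdsWithin_iff.1 hc
  have hcx₀ : c < g x₀ := hball ⟨Metric.mem_ball_self hδ, hx₀⟩
  refine ⟨2 * (g x₀ - c) / δ, div_nonneg (by linarith) hδ.le, fun x hx => ?_⟩
  rcases lt_or_ge ‖x - x₀‖ δ with hlt | hge
  · have hcx : c < g x := hball ⟨mem_ball_iff_norm.2 hlt, hx⟩
    have hslope : 0 ≤ 2 * (g x₀ - c) / δ * ‖x - x₀‖ :=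
      mul_nonneg (div_nonneg (by linarith) hδ.le) (norm_nonneg _)
    linarith
  · have hpos : 0 < ‖x - x₀‖ := hδ.trans_le hge
    set t := δ / (2 * ‖x - x₀‖) with ht
    have ht0 : 0 < t := by positivity
    have ht1 : t ≤ 1 := by rw [ht, div_le_one (by positivity)]; linarith
    have htδ : t * ‖x - x₀‖ = δ / 2 := by rw [ht]; field_simp
    have hmem : c < g (x₀ + t • (x - x₀)) := by
      refine hball ⟨mem_ball_iff_norm.2 ?_, hg.1.add_smul_sub_mem hx₀ hx ⟨ht0.le, ht1⟩⟩
      rw [add_sub_cancel_left, norm_smul, Real.norm_of_nonneg ht0.le, htδ]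
      exact half_lt_self hδ
    have hconv := hg.2 hx₀ hx (sub_nonneg.2 ht1) ht0.le (sub_add_cancel 1 t)
    rw [show (1 - t) • x₀ + t • x = x₀ + t • (x - x₀) by module, smul_eq_mul,
      smul_eq_mul] at hconv
    have hslope : t * (2 * (g x₀ - c) / δ * ‖x - x₀‖) = g x₀ - c := by
      rw [mul_left_comm, htδ]
      field_simp
    have hscaled : t * (c - 2 * (g x₀ - c) / δ * ‖x - x₀‖) ≤ t * g x := by
      rw [mul_sub, hslope]
      linarith [mul_pos ht0 (sub_pos.2 hcx₀)]
    exact le_of_mul_le_mul_left hscaled ht0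

theorem exists_sub_mul_norm_sub_le_toReal (hbot : ∀ x, φ x ≠ ⊥) (hφ : ERealConvex φ)
    (hlsc : LowerSemicontinuous φ) {x₀ : E} (hx₀ : x₀ ∈ effDomain φ) :
    ∃ k ≥ 0, ∀ x ∈ effDomain φ, (φ x₀).toReal - 1 - k * ‖x - x₀‖ ≤ (φ x).toReal := by
  refine exists_sub_mul_norm_sub_le (convexOn_toReal hbot hφ) hx₀ ?_
  have hlt : (((φ x₀).toReal - 1 : ℝ) : EReal) < φ x₀ := by
    conv_rhs => rw [← coe_toReal_of_mem_effDomain hbot hx₀]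
    exact EReal.coe_lt_coe_iff.2 (sub_one_lt _)
  filter_upwards [nhdsWithin_le_nhds (hlsc x₀ _ hlt), self_mem_nhdsWithin] with x hx hxφ
  rw [← coe_toReal_of_mem_effDomain hbot hxφ] at hx
  exact EReal.coe_lt_coe_iff.1 hx

end Energy

section ClarkeBound

variable {E Z : Type*} [NormedAddCommGroup E] [NormedSpace ℝ E] [NormedAddCommGroup Z] {h : Z → ℝ}

theorem BoundedLocalLipschitz.locallyLipschitz (hh : BoundedLocalLipschitz h) :
    LocallyLipschitz h := fun z => by
  obtain ⟨c, -, -, hLip, -⟩ := hh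
  exact ⟨c z, hLip z⟩

variable [NormedSpace ℝ Z]

theorem BoundedLocalLipschitz.exists_clarkeDeriv_le (hh : BoundedLocalLipschitz h) :
    ∃ α ≥ 0, ∀ z y, clarkeDeriv h z y ≤ α * ‖y‖ := by
  obtain ⟨c, α, -, hLip, hcα⟩ := hh
  refine ⟨α, α.2, fun z y => ?_⟩
  obtain ⟨U, hU, hLipU⟩ := hLip z
  exact (le_abs_self _).trans (abs_clarkeDeriv_le hU (hLipU.weaken (hcα z)) y)

theorem BoundedLocalLipschitz.exists_mul_clarkeDeriv_le (hh : BoundedLocalLipschitz h)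
    (γ : E →L[ℝ] Z) {c : E → ℝ} (hc : ∀ u, 0 ≤ c u) (hcb : BddAbove (Set.range c)) :
    ∃ a ≥ 0, ∀ u d, c u * clarkeDeriv h (γ u) (γ d) ≤ a * ‖d‖ := by
  obtain ⟨α, hα, hle⟩ := hh.exists_clarkeDeriv_le
  obtain ⟨m, hm⟩ := hcb
  have hcm (u : E) : c u ≤ m := hm ⟨u, rfl⟩
  refine ⟨m * (α * ‖γ‖), mul_nonneg ((hc 0).trans (hcm 0)) (by positivity), fun u d => ?_⟩
  calc c u * clarkeDeriv h (γ u) (γ d)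
      ≤ c u * (α * ‖γ d‖) := mul_le_mul_of_nonneg_left (hle _ _) (hc u)
    _ ≤ m * (α * (‖γ‖ * ‖d‖)) := by
        gcongr
        exacts [(hc u).trans (hcm u), hcm u, γ.le_opNorm d]
    _ = m * (α * ‖γ‖) * ‖d‖ := by ring

end ClarkeBound

section Coupled

variable {X Y Z₁ Z₂ : Type*} [NormedAddCommGroup X] [NormedAddCommGroup Y]

/-- The pairs of `K × Λ` at whose first component `φ` is finite. -/
def admissible (K : Set X) (Λ : Set Y) (φ : X → EReal) : Set (X × Y) :=
  K ×ˢ Λ ∩ effDomain fun p => φ p.1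

theorem exists_inter_closedBall_nonempty_and_norm_lt {E : Type*} [SeminormedAddCommGroup E]
    {M : Set E} (hne : M.Nonempty) (hb : Bornology.IsBounded M) :
    ∃ ρ, (M ∩ Metric.closedBall 0 ρ).Nonempty ∧ ∀ p ∈ M, ‖p‖ < ρ := by
  obtain ⟨R, hR⟩ := hb.exists_norm_le
  obtain ⟨q, hq⟩ := hne
  have hlt (p : E) (hp : p ∈ M) : ‖p‖ < R + 1 := (hR p hp).trans_lt (lt_add_one R)
  exact ⟨R + 1, ⟨q, hq, mem_closedBall_zero_iff.2 (hlt q hq).le⟩, hlt⟩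

theorem norm_le_pairNorm (p : X × Y) : ‖p‖ ≤ pairNorm p :=
  max_le (Real.le_sqrt_of_sq_le (le_add_of_nonneg_right (sq_nonneg _)))
    (Real.le_sqrt_of_sq_le (le_add_of_nonneg_left (sq_nonneg _)))

theorem norm_sub_le_one_add_mul {E : Type*} [SeminormedAddCommGroup E] (w u : E) {r : ℝ}
    (hu : ‖u‖ ≤ r) (hr : 1 ≤ r) : ‖w - u‖ ≤ (1 + ‖w‖) * r := by
  linarith [norm_sub_le w u, le_mul_of_one_le_right (norm_nonneg w) hr]

theorem one_add_mul_norm_sub_le_mul_pairNorm {a b : ℝ} (ha : 0 ≤ a) (hb : 0 ≤ b) (q : X × Y)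
    {p : X × Y} (hp : 1 ≤ pairNorm p) :
    1 + a * ‖q.1 - p.1‖ + b * ‖q.2 - p.2‖ ≤
      (1 + a * (1 + ‖q.1‖) + b * (1 + ‖q.2‖)) * pairNorm p := by
  have hnorm := norm_le_pairNorm p
  have hfst := mul_le_mul_of_nonneg_left
    (norm_sub_le_one_add_mul q.1 p.1 ((norm_fst_le p).trans hnorm) hp) ha
  have hsnd := mul_le_mul_of_nonneg_left
    (norm_sub_le_one_add_mul q.2 p.2 ((norm_snd_le p).trans hnorm) hp) hb
  linarith

variable [NormedSpace ℝ X] [NormedSpace ℝ Y]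
  [NormedAddCommGroup Z₁] [NormedSpace ℝ Z₁] [NormedAddCommGroup Z₂] [NormedSpace ℝ Z₂]
  {K : Set X} {Λ : Set Y} {B : X × Y → ℝ} {φ : X → EReal} {γ₁ : X →L[ℝ] Z₁} {γ₂ : Y →L[ℝ] Z₂}
  {J : Z₁ → ℝ} {L : Z₂ → ℝ} {H : Y → ℝ} {F : X → StrongDual ℝ X} {G : Y → StrongDual ℝ Y}

/-- The bifunction on `X × Y` whose equilibria solve the coupled system: the sum of the
hemivariational forms of the two inequalities. -/
noncomputable def coupledForm (γ₁ : X →L[ℝ] Z₁) (γ₂ : Y →L[ℝ] Z₂) (J : Z₁ → ℝ) (L : Z₂ → ℝ)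
    (H : Y → ℝ) (F : X → StrongDual ℝ X) (G : Y → StrongDual ℝ Y) (p d : X × Y) : ℝ :=
  hemivariationalForm F (fun _ => 1) γ₁ J p.1 d.1 + hemivariationalForm G H γ₂ L p.2 d.2

theorem isSublinear_coupledForm (hJ : LocallyLipschitz J) (hL : LocallyLipschitz L)
    (hH : ∀ σ, 0 ≤ H σ) (p : X × Y) : IsSublinear (coupledForm γ₁ γ₂ J L H F G p) :=
  ((isSublinear_hemivariationalForm (c := fun _ => 1) hJ zero_le_one).comp_linearMap
    (LinearMap.fst ℝ X Y)).add
      ((isSublinear_hemivariationalForm hL (hH p.2)).comp_linearMap (LinearMap.snd ℝ X Y))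

section IsEquilibrium

variable {M : Set (X × Y)} {p : X × Y}
  (hp : IsEquilibrium M (energy B fun p => φ p.1) (coupledForm γ₁ γ₂ J L H F G) p)
include hp

theorem IsEquilibrium.apply_fst_le (hL : LocallyLipschitz L) {v : X} (hv : (v, p.2) ∈ M) :
    F p.1 (v - p.1) ≤ B (v, p.2) - B p + ((φ v).toReal - (φ p.1).toReal) +
      clarkeDeriv J (γ₁ p.1) (γ₁ (v - p.1)) := by
  have hle := hp.2 _ hv
  simp only [coupledForm, Prod.fst_sub, Prod.snd_sub, sub_self, hemivariationalForm_zero hL] at hle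
  simp only [hemivariationalForm, energy] at hle
  linarith

theorem IsEquilibrium.apply_snd_le (hJ : LocallyLipschitz J) {μ : Y} (hμ : (p.1, μ) ∈ M) :
    G p.2 (μ - p.2) ≤ B (p.1, μ) - B p + H p.2 * clarkeDeriv L (γ₂ p.2) (γ₂ (μ - p.2)) := by
  have hle := hp.2 _ hμ
  simp only [coupledForm, Prod.fst_sub, Prod.snd_sub, sub_self, hemivariationalForm_zero hJ] at hle
  simp only [hemivariationalForm, energy] at hle
  linarith

theorem IsEquilibrium.coercive_numerator_le (hJ : LocallyLipschitz J) (hL : LocallyLipschitz L)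
    {w : X} {τ : Y} (hw : (w, p.2) ∈ M) (hτ : (p.1, τ) ∈ M) :
    2 * B p - B (w, p.2) - B (p.1, τ) + F p.1 (w - p.1) + G p.2 (τ - p.2) ≤
      (φ w).toReal - (φ p.1).toReal + clarkeDeriv J (γ₁ p.1) (γ₁ (w - p.1)) +
        H p.2 * clarkeDeriv L (γ₂ p.2) (γ₂ (τ - p.2)) := by
  linarith [hp.apply_fst_le hL hw, hp.apply_snd_le hJ hτ]

end IsEquilibrium

theorem IsEquilibrium.isSolution (hJ : LocallyLipschitz J) (hL : LocallyLipschitz L)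
    (hbot : ∀ x, φ x ≠ ⊥) {p : X × Y}
    (hp : IsEquilibrium (admissible K Λ φ) (energy B fun p => φ p.1)
      (coupledForm γ₁ γ₂ J L H F G) p) :
    IsSolution K Λ B φ γ₁ γ₂ J L H F G p.1 p.2 := by
  have ⟨⟨hpK, hpΛ⟩, hpφ⟩ := hp.1
  refine ⟨⟨hpK, hpφ⟩, hpΛ, fun v hv => ?_, fun μ hμ => ?_⟩
  · rw [← coe_toReal_of_mem_effDomain hbot hpφ]
    by_cases hvφ : v ∈ effDomain φ
    · rw [← coe_toReal_of_mem_effDomain hbot hvφ, ← EReal.coe_sub, ← EReal.coe_add,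
        ← EReal.coe_add, EReal.coe_le_coe_iff]
      exact hp.apply_fst_le hL ⟨⟨hv, hpΛ⟩, hvφ⟩
    · have htop : φ v = ⊤ := not_lt_top_iff.1 hvφ
      rw [htop, EReal.top_sub_coe, EReal.coe_add_top, EReal.top_add_coe]
      exact le_top
  · exact hp.apply_snd_le hJ ⟨⟨hpK, hμ⟩, hpφ⟩

theorem exists_coercive_numerator_le_mul_pairNorm (hbot : ∀ x, φ x ≠ ⊥) (hφ : ERealConvex φ)
    (hlsc : LowerSemicontinuous φ) (hJ : BoundedLocalLipschitz J) (hL : BoundedLocalLipschitz L)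
    (hH : ∀ σ, 0 ≤ H σ) (hHb : BddAbove (Set.range H)) {w : X} (hw : w ∈ effDomain φ) (τ : Y) :
    ∃ C, ∀ (M : Set (X × Y)) (p : X × Y),
      IsEquilibrium M (energy B fun p => φ p.1) (coupledForm γ₁ γ₂ J L H F G) p →
      (w, p.2) ∈ M → (p.1, τ) ∈ M → p.1 ∈ effDomain φ → 1 ≤ pairNorm p →
      2 * B p - B (w, p.2) - B (p.1, τ) + F p.1 (w - p.1) + G p.2 (τ - p.2) ≤ C * pairNorm p := by
  obtain ⟨k, hk, hlow⟩ := exists_sub_mul_norm_sub_le_toReal hbot hφ hlsc hw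
  obtain ⟨a, ha, hJa⟩ := hJ.exists_mul_clarkeDeriv_le γ₁ (c := fun _ => 1) (fun _ => zero_le_one)
    Set.finite_range_const.bddAbove
  obtain ⟨b, hb, hLb⟩ := hL.exists_mul_clarkeDeriv_le γ₂ hH hHb
  refine ⟨1 + (k + a) * (1 + ‖w‖) + b * (1 + ‖τ‖), fun M p hp hwM hτM hpφ hpair => ?_⟩
  have hφp := hlow p.1 hpφ
  have hJp := hJa p.1 (w - p.1)
  rw [norm_sub_rev] at hφp
  rw [one_mul] at hJp
  calc 2 * B p - B (w, p.2) - B (p.1, τ) + F p.1 (w - p.1) + G p.2 (τ - p.2)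
      ≤ (φ w).toReal - (φ p.1).toReal + clarkeDeriv J (γ₁ p.1) (γ₁ (w - p.1)) +
          H p.2 * clarkeDeriv L (γ₂ p.2) (γ₂ (τ - p.2)) :=
        hp.coercive_numerator_le hJ.locallyLipschitz hL.locallyLipschitz hwM hτM
    _ ≤ 1 + (k + a) * ‖w - p.1‖ + b * ‖τ - p.2‖ := by linarith [hLb p.2 (τ - p.2)]
    _ ≤ (1 + (k + a) * (1 + ‖w‖) + b * (1 + ‖τ‖)) * pairNorm p :=
        one_add_mul_norm_sub_le_mul_pairNorm (add_nonneg hk ha) hb (w, τ) hpair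

theorem Coercive.exists_forall_norm_lt (hC : Coercive K Λ φ B F G) (hbot : ∀ x, φ x ≠ ⊥)
    (hφ : ERealConvex φ) (hlsc : LowerSemicontinuous φ) (hJ : BoundedLocalLipschitz J)
    (hL : BoundedLocalLipschitz L) (hH : ∀ σ, 0 ≤ H σ) (hHb : BddAbove (Set.range H)) :
    ∃ ρ, (admissible K Λ φ ∩ Metric.closedBall 0 ρ).Nonempty ∧
      ∀ p, IsEquilibrium (admissible K Λ φ ∩ Metric.closedBall 0 ρ) (energy B fun p => φ p.1)
        (coupledForm γ₁ γ₂ J L H F G) p → ‖p‖ < ρ := by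
  obtain ⟨w₀, ⟨hw₀K, hw₀φ⟩, τ₀, hτ₀, hlim⟩ := hC
  obtain ⟨C, hbound⟩ := exists_coercive_numerator_le_mul_pairNorm (γ₁ := γ₁) (γ₂ := γ₂) (B := B)
    (F := F) (G := G) hbot hφ hlsc hJ hL hH hHb hw₀φ τ₀
  have hlarge := hlim.eventually_gt_atTop C
  rw [eventually_inf_principal, eventually_comap] at hlarge
  obtain ⟨ρ, hρ, hρ1, hρ₀⟩ := ((eventually_forall_ge_atTop.2 hlarge).and
    ((eventually_ge_atTop 1).and (eventually_ge_atTop ‖(w₀, τ₀)‖))).exists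
  have hball {p : X × Y} : p ∈ Metric.closedBall 0 ρ ↔ ‖p.1‖ ≤ ρ ∧ ‖p.2‖ ≤ ρ := by
    rw [mem_closedBall_zero_iff, norm_prod_le_iff]
  have hw₀τ₀ := hball.1 (mem_closedBall_zero_iff.2 hρ₀)
  refine ⟨ρ, ⟨(w₀, τ₀), ⟨⟨hw₀K, hτ₀⟩, hw₀φ⟩, hball.2 hw₀τ₀⟩, fun p hp => ?_⟩
  have ⟨⟨⟨hpK, hpΛ⟩, hpφ⟩, hpρ⟩ := hp.1
  by_contra! hge
  have hpair := hge.trans (norm_le_pairNorm p)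
  have hquot := hρ _ hpair p rfl ⟨hpK, hpΛ⟩
  rw [lt_div_iff₀ (zero_lt_one.trans_le (hρ1.trans hpair))] at hquot
  refine hquot.not_ge (hbound _ p hp ?_ ?_ hpφ (hρ1.trans hpair))
  · exact ⟨⟨⟨hw₀K, hpΛ⟩, hw₀φ⟩, hball.2 ⟨hw₀τ₀.1, (hball.1 hpρ).2⟩⟩
  · exact ⟨⟨⟨hpK, hτ₀⟩, hpφ⟩, hball.2 ⟨(hball.1 hpρ).1, hw₀τ₀.2⟩⟩

theorem exists_forall_isEquilibrium_norm_lt (hΛ : Λ.Nonempty) (hφK : (effDomain φ ∩ K).Nonempty)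
    (hbot : ∀ x, φ x ≠ ⊥) (hφ : ERealConvex φ) (hlsc : LowerSemicontinuous φ)
    (hH : ∀ σ, 0 ≤ H σ) (hKΛ : Bornology.IsBounded (K ×ˢ Λ) ∨ (Coercive K Λ φ B F G ∧
      BoundedLocalLipschitz J ∧ BoundedLocalLipschitz L ∧ BddAbove (Set.range H))) :
    ∃ ρ, (admissible K Λ φ ∩ Metric.closedBall 0 ρ).Nonempty ∧
      ∀ p, IsEquilibrium (admissible K Λ φ ∩ Metric.closedBall 0 ρ) (energy B fun p => φ p.1)
        (coupledForm γ₁ γ₂ J L H F G) p → ‖p‖ < ρ := by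
  obtain ⟨u, huφ, huK⟩ := hφK
  obtain ⟨σ, hσ⟩ := hΛ
  rcases hKΛ with hb | ⟨hC, hJ, hL, hHb⟩
  · obtain ⟨ρ, hne, hρ⟩ := exists_inter_closedBall_nonempty_and_norm_lt
      (M := admissible K Λ φ) ⟨(u, σ), ⟨huK, hσ⟩, huφ⟩ (hb.subset Set.inter_subset_left)
    exact ⟨ρ, hne, fun p hp => hρ p hp.1.1⟩
  · exact hC.exists_forall_norm_lt hbot hφ hlsc hJ hL hH hHb

end Coupled

end CoupledIneq

theorem mainTheorem3_general {X Y Z₁ Z₂ : Type*}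
    [NormedAddCommGroup X] [NormedSpace ℝ X] [NormedAddCommGroup Y] [NormedSpace ℝ Y]
    [NormedAddCommGroup Z₁] [NormedSpace ℝ Z₁] [NormedAddCommGroup Z₂] [NormedSpace ℝ Z₂]
    (hX : CoupledIneq.Reflexive X) (hY : CoupledIneq.Reflexive Y)
    {K : Set X} (hKcl : IsClosed K) {Λ : Set Y} (hΛne : Λ.Nonempty) (hΛcl : IsClosed Λ)
    {B : X × Y → ℝ} {φ : X → EReal}
    {γ₁ : X →L[ℝ] Z₁} {γ₂ : Y →L[ℝ] Z₂} {J : Z₁ → ℝ} {L : Z₂ → ℝ} {H : Y → ℝ}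
    {F : X → StrongDual ℝ X} {G : Y → StrongDual ℝ Y}
    (hφbot : ∀ x, φ x ≠ ⊥) (hφconv : CoupledIneq.ERealConvex φ)
    (hφlsc : LowerSemicontinuous φ) (hφK : (CoupledIneq.effDomain φ ∩ K).Nonempty)
    (hJ : LocallyLipschitz J) (hL : LocallyLipschitz L)
    (hγ₁ : IsCompactOperator γ₁) (hγ₂ : IsCompactOperator γ₂) (hH : ∀ σ, 0 ≤ H σ)
    (hHcont : ∀ (σ : Y) (s : ℕ → Y), CoupledIneq.WeaklyTendsto s σ →
      Tendsto (fun n => H (s n)) atTop (𝓝 (H σ)))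
    (hBconv : ConvexOn ℝ (K ×ˢ Λ) B) (hBlsc : LowerSemicontinuousOn B (K ×ˢ Λ))
    (hF : CoupledIneq.OpCond1 F ∨ CoupledIneq.OpCond2 F ∨
      CoupledIneq.OpCond3 F (fun _ => 1) γ₁ J)
    (hG : CoupledIneq.OpCond1 G ∨ CoupledIneq.OpCond2 G ∨ CoupledIneq.OpCond3 G H γ₂ L)
    (hKΛ : Bornology.IsBounded (K ×ˢ Λ) ∨ (CoupledIneq.Coercive K Λ φ B F G ∧
      CoupledIneq.BoundedLocalLipschitz J ∧ CoupledIneq.BoundedLocalLipschitz L ∧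
      BddAbove (Set.range H))) :
    ∃ (u : X) (σ : Y), CoupledIneq.IsSolution K Λ B φ γ₁ γ₂ J L H F G u σ := by
  obtain ⟨f', hf'⟩ := CoupledIneq.exists_isCompanion_hemivariationalForm hJ hγ₁
    (fun _ => zero_le_one) (fun _ _ _ => tendsto_const_nhds) hF
  obtain ⟨g', hg'⟩ := CoupledIneq.exists_isCompanion_hemivariationalForm hL hγ₂ hH hHcont hG
  obtain ⟨ρ, hne, hρ⟩ := CoupledIneq.exists_forall_isEquilibrium_norm_lt (γ₁ := γ₁) (γ₂ := γ₂)
    hΛne hφK hφbot hφconv hφlsc hH hKΛ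
  obtain ⟨p, hp⟩ := (hX.prod hY).exists_isEquilibrium_of_norm_lt (hf'.prod hg')
    (CoupledIneq.isSublinear_coupledForm hJ hL hH)
    (CoupledIneq.convexOn_energy (fun p => hφbot p.1) (fun p q => hφconv p.1 q.1) hBconv)
    (CoupledIneq.isClosed_sublevel_energy (hKcl.prod hΛcl) (fun p => hφbot p.1)
      (hφlsc.comp continuous_fst) hBlsc) hne hρ
  exact ⟨p.1, p.2, hp.isSolution hJ hL hφbot⟩

theorem mainTheorem3 {X Y Z₁ Z₂ : Type*}
    [NormedAddCommGroup X] [NormedSpace ℝ X] [CompleteSpace X]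
    [NormedAddCommGroup Y] [NormedSpace ℝ Y] [CompleteSpace Y]
    [NormedAddCommGroup Z₁] [NormedSpace ℝ Z₁] [CompleteSpace Z₁]
    [NormedAddCommGroup Z₂] [NormedSpace ℝ Z₂] [CompleteSpace Z₂]
    (hX : CoupledIneq.Reflexive X) (hY : CoupledIneq.Reflexive Y)
    (K : Set X) (hKne : K.Nonempty) (hKcl : IsClosed K) (hKconv : Convex ℝ K)
    (Λ : Set Y) (hΛne : Λ.Nonempty) (hΛcl : IsClosed Λ) (hΛconv : Convex ℝ Λ)
    (B : X × Y → ℝ) (φ : X → EReal)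
    (γ₁ : X →L[ℝ] Z₁) (γ₂ : Y →L[ℝ] Z₂) (J : Z₁ → ℝ) (L : Z₂ → ℝ) (H : Y → ℝ)
    (F : X → StrongDual ℝ X) (G : Y → StrongDual ℝ Y)
    (hφbot : ∀ x, φ x ≠ ⊥) (hφconv : CoupledIneq.ERealConvex φ)
    (hφlsc : LowerSemicontinuous φ) (hφK : (CoupledIneq.effDomain φ ∩ K).Nonempty)
    (hJ : CoupledIneq.BoundedLocalLipschitz J) (hL : CoupledIneq.BoundedLocalLipschitz L)
    (hγ₁ : IsCompactOperator γ₁) (hγ₂ : IsCompactOperator γ₂)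
    (hHbd : ∃ m : ℝ, 0 < m ∧ ∀ σ, 0 < H σ ∧ H σ < m)
    (hHcont : ∀ (σ : Y) (s : ℕ → Y), CoupledIneq.WeaklyTendsto s σ →
      Tendsto (fun n => H (s n)) atTop (𝓝 (H σ)))
    (hBconv : ConvexOn ℝ Set.univ B) (hBlsc : LowerSemicontinuous B)
    (hF : CoupledIneq.OpCond1 F ∨ CoupledIneq.OpCond2 F ∨
      CoupledIneq.OpCond3 F (fun _ => 1) γ₁ J)
    (hG : CoupledIneq.OpCond1 G ∨ CoupledIneq.OpCond2 G ∨ CoupledIneq.OpCond3 G H γ₂ L)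
    (hKΛ : Bornology.IsBounded (K ×ˢ Λ) ∨ CoupledIneq.Coercive K Λ φ B F G) :
    ∃ (u : X) (σ : Y), CoupledIneq.IsSolution K Λ B φ γ₁ γ₂ J L H F G u σ := by
  obtain ⟨m, -, hH⟩ := hHbd
  exact mainTheorem3_general hX hY hKcl hΛne hΛcl hφbot hφconv hφlsc hφK
    hJ.locallyLipschitz hL.locallyLipschitz hγ₁ hγ₂ (fun σ => (hH σ).1.le) hHcont
    (hBconv.subset (Set.subset_univ _) (hKconv.prod hΛconv)) (hBlsc.lowerSemicontinuousOn _) hF hG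
    (hKΛ.imp_right fun hC => ⟨hC, hJ, hL, m, Set.forall_mem_range.2 fun σ => (hH σ).2.le⟩)
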